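/- **Setting.** Let $\partial\mathbf H^2_{\mathbb C}\cong S^3$ be the set of null lines of the Hermitian form $\langle z,w\rangle=z_1\overline{w_3}+z_2\overline{w_2}+z_3\overline{w_1}$ on $\mathbb C^3$, and write $(z,t)\in\mathbb C\times\mathbb R$ for the boundary point spanned by $[-|z|^2+it,\sqrt2\,z,1]$ and $\infty$ for the one spanned by $[1,0,0]$. A $\mathbb C$-circle is the set of boundary points on a complex projective line that contains a negative vector. Let $\mathfrak F_4''$ be the set of $\mathrm{PU}(2,1)$-orbits of ordered quadruples $(p_1,p_2,p_3,p_4)$ of pairwise distinct points of $\partial\mathbf H^2_{\mathbb C}$ such that neither $p_1,p_2,p_3$ nor $p_2,p_3,p_4$ lie on a common $\mathbb C$-circle, and $p_1,p_4$ are not in the same orbit of the (pointwise) stabiliser of $p_2$ and $p_3$. On $\mathcal C(\mathfrak H^\star)=\mathbb C_*\times\mathbb R\times\mathbb R_{>0}$, with coordinates $(z=x+iy,t,r)$, consider the frame $$\mathbf X=x\partial_x+y\partial_y,\quad \mathbf Y=x\partial_y-y\partial_x-2|z|^2\partial_t,\quad \mathbf T=x\partial_y-y\partial_x,\quad \mathbf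 S=r\partial_r,$$ and the almost complex structure $\mathbb J\mathbf X=\mathbf Y$, $\mathbb J\mathbf Y=-\mathbf X$, $\mathbb J\mathbf T=-\mathbf S$, $\mathbb J\mathbf S=\mathbf T$ (this is the complex structure of the Kähler cone over the affine-rotational group $\mathfrak H^\star$). Let $\mathcal H^\star=\langle\mathbf X,\mathbf Y\rangle$ and let $\mathcal C'(\mathfrak H^\star)$ be the open subset where $\log r\ne t/|z|^2$. **Theorem.** Every element of $\mathfrak F_4''$ has a unique representative of the form $p_1=(1,\tan a)$, $p_2=\infty$, $p_3=(0,0)$, $p_4=(z,t)$ with $a\in(-\pi/2,\pi/2)$. Define, in terms of this representative, $$\mathcal B_0([\mathfrak p])=(z,t,e^{\tan a}),\qquad \mathcal B_1([\mathfrak p])=\Bigl(z,\ \frac{|z|^2-it}{1-i\tan a}\Bigr).$$ Then $\mathcal B_0$ is a bijection of $\mathfrak F_4''$ onto $\mathcal C'(\mathfrak H^\star)$, $\mathcal B_1$ is a bijection of $\mathfrak F_4''$ onto $\mathbb C_*\times(\mathbb C\setminus\mathbb R)$, and $\mathfrak F_4''$ admits two structures $M_0,M_1$ of two-dimensional complex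 manifold such that $\mathcal B_0$ is a biholomorphism from $(\mathfrak F_4'',M_0)$ onto $(\mathcal C'(\mathfrak H^\star),\mathbb J)$ (a smooth diffeomorphism whose differential intertwines the complex structures) and $\mathcal B_1$ is a biholomorphism from $(\mathfrak F_4'',M_1)$ onto $\mathbb C_*\times(\mathbb C\setminus\mathbb R)$ with its standard complex structure. The identity map $(\mathfrak F_4'',M_0)\to(\mathfrak F_4'',M_1)$ is a smooth diffeomorphism. The subbundle $\mathcal H=\{v: d\mathcal B_0(v)\in\mathcal H^\star\}$ of the tangent bundle of $\mathfrak F_4''$ is a bundle of complex lines for each of the two structures, and the identity map is CR: its differential maps $\mathcal H$ to $\mathcal H$ and commutes there with the two complex structures. However, the identity map is not biholomorphic from $(\mathfrak F_4'',M_0)$ to $(\mathfrak F_4'',M_1)$. -/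

import Mathlib

open scoped Manifold ContDiff LinearAlgebra.Projectivization

noncomputable section

namespace FourPoints

/-! ### The boundary of the complex hyperbolic plane and the group `PU(2,1)` -/

/-- The Hermitian form of signature `(2,1)` on `ℂ³`:
`⟨z, w⟩ = z₁ w̄₃ + z₂ w̄₂ + z₃ w̄₁` (coordinates are indexed by `0, 1, 2` below). -/
def herm (z w : Fin 3 → ℂ) : ℂ :=
  z 0 * star (w 2) + z 1 * star (w 1) + z 2 * star (w 0)

/-- The unitary group `U(2,1)` of the form `herm`. -/
def U21 : Subgroup ((Fin 3 → ℂ) ≃ₗ[ℂ] (Fin 3 → ℂ)) where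
  carrier := {g | ∀ z w, herm (g z) (g w) = herm z w}
  mul_mem' := by
    intro g h hg hh z w
    simp only [LinearEquiv.mul_apply]
    rw [hg, hh]
  one_mem' := by
    intro z w
    rfl
  inv_mem' := by
    intro g hg z w
    have h := hg (g⁻¹ z) (g⁻¹ w)
    rw [← LinearEquiv.mul_apply, ← LinearEquiv.mul_apply, mul_inv_cancel] at h
    exact h.symm

/-- The projective unitary group `PU(2,1)`, as a group of transformations of the projective
plane `ℂP²`: the image of `U(2,1)` in the group of permutations of `ℂP²`. -/
def PU21 : Subgroup (Equiv.Perm (ℙ ℂ (Fin 3 → ℂ))) :=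
  U21.map (MulAction.toPermHom ((Fin 3 → ℂ) ≃ₗ[ℂ] (Fin 3 → ℂ)) (ℙ ℂ (Fin 3 → ℂ)))

/-- The boundary `∂H²_ℂ ≅ S³` of the complex hyperbolic plane: the null lines of `herm`. -/
def boundary : Set (ℙ ℂ (Fin 3 → ℂ)) :=
  {p | ∀ v ∈ p.submodule, herm v v = 0}

/-- A `ℂ`-circle: the set of boundary points lying on a complex projective line
(the projectivisation of a two-dimensional subspace `W`) that meets the complex hyperbolic plane,
i.e. such that `W` contains a negative vector. -/
def IsCCircle (S : Set (ℙ ℂ (Fin 3 → ℂ))) : Prop :=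
  ∃ W : Submodule ℂ (Fin 3 → ℂ), Module.finrank ℂ W = 2 ∧ (∃ v ∈ W, (herm v v).re < 0) ∧
    S = {p | p ∈ boundary ∧ p.submodule ≤ W}

/-- The point at infinity `[1, 0, 0]`. -/
def infty : ℙ ℂ (Fin 3 → ℂ) :=
  Projectivization.mk ℂ ![1, 0, 0] (fun h => one_ne_zero (congrFun h 0))

/-- The boundary point with Heisenberg coordinates `(z, t)`, through its standard lift
`[-|z|² + i t, √2 z, 1]`. -/
def heis (z : ℂ) (t : ℝ) : ℙ ℂ (Fin 3 → ℂ) :=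
  Projectivization.mk ℂ ![-((‖z‖ ^ 2 : ℝ) : ℂ) + Complex.I * t, (Real.sqrt 2 : ℂ) * z, 1]
    (fun h => one_ne_zero (congrFun h 2))

/-! ### Configurations of four points -/

/-- Ordered quadruples `(p₁, p₂, p₃, p₄)` of pairwise distinct boundary points
(indexed by `0, 1, 2, 3`). -/
def C4 : Set (Fin 4 → ℙ ℂ (Fin 3 → ℂ)) :=
  {p | Function.Injective p ∧ ∀ i, p i ∈ boundary}

/-- Two quadruples are equivalent if they lie in the same orbit of the diagonal action of
`PU(2,1)`. -/
def configSetoid : Setoid C4 :=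
  (MulAction.orbitRel PU21 (Fin 4 → ℙ ℂ (Fin 3 → ℂ))).comap Subtype.val

/-- The configuration space of four points in the boundary. -/
def F4 : Type := Quotient configSetoid

/-- The quadruples such that `p₁, p₂, p₃` do not lie in a common `ℂ`-circle, `p₂, p₃, p₄` do not
lie in a common `ℂ`-circle, and `p₁, p₄` are not in the same orbit of the (pointwise) stabiliser
of `p₂` and `p₃`. -/
def C4'' : Set (Fin 4 → ℙ ℂ (Fin 3 → ℂ)) :=
  {p | p ∈ C4 ∧
    (¬ ∃ S, IsCCircle S ∧ p 0 ∈ S ∧ p 1 ∈ S ∧ p 2 ∈ S) ∧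
    (¬ ∃ S, IsCCircle S ∧ p 1 ∈ S ∧ p 2 ∈ S ∧ p 3 ∈ S) ∧
    (¬ ∃ g ∈ PU21, g (p 1) = p 1 ∧ g (p 2) = p 2 ∧ g (p 0) = p 3)}

/-- The subset `F₄''` of the configuration space: the orbits of quadruples in `C₄''`. -/
def F4'' : Type :=
  {x : F4 // ∃ p : C4, (p : Fin 4 → ℙ ℂ (Fin 3 → ℂ)) ∈ C4'' ∧ Quotient.mk configSetoid p = x}

/-- The normalised quadruple `p₁ = (1, tan a)`, `p₂ = ∞`, `p₃ = (0, 0)`, `p₄ = (z, t)`. -/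
def normalQuad (a : ℝ) (z : ℂ) (t : ℝ) : Fin 4 → ℙ ℂ (Fin 3 → ℂ) :=
  ![heis 1 (Real.tan a), infty, heis 0 0, heis z t]

/-- `(a, z, t)` are parameters, with `-π/2 < a < π/2`, of a normalised quadruple
representing the class `x`. -/
def IsNormalForm (x : F4'') (q : ℝ × ℂ × ℝ) : Prop :=
  q.1 ∈ Set.Ioo (-(Real.pi / 2)) (Real.pi / 2) ∧
    ∃ h : normalQuad q.1 q.2.1 q.2.2 ∈ C4,
      Quotient.mk configSetoid ⟨normalQuad q.1 q.2.1 q.2.2, h⟩ = x.1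

/-- The parameters `(a, z, t)` of the normalised representative of `x` (their existence and
uniqueness is part of the theorem). -/
def normalForm (x : F4'') : ℝ × ℂ × ℝ :=
  Classical.epsilon (IsNormalForm x)

/-- The map `B₀ : [p] ↦ (z, t, e^{tan a})`. -/
def B0 (x : F4'') : ℂ × ℝ × ℝ :=
  ((normalForm x).2.1, (normalForm x).2.2, Real.exp (Real.tan (normalForm x).1))

/-- The map `B₁ : [p] ↦ (z, (|z|² - i t) / (1 - i tan a))`. -/
def B1 (x : F4'') : ℂ × ℂ :=
  ((normalForm x).2.1,
    (((‖(normalForm x).2.1‖ ^ 2 : ℝ) : ℂ) - Complex.I * ((normalForm x).2.2 : ℂ)) /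
      (1 - Complex.I * (Real.tan (normalForm x).1 : ℂ)))

/-! ### The cone over the affine-rotational group, with its complex structure -/

/-- The open part `C'(H⋆)` of the cone `C(H⋆) = (ℂ∖{0}) × ℝ × ℝ_{>0}`, with coordinates
`(z, t, r)`, where `log r ≠ t / |z|²`. -/
def cone' : Set (ℂ × ℝ × ℝ) :=
  {p | p.1 ≠ 0 ∧ 0 < p.2.2 ∧ Real.log p.2.2 ≠ p.2.1 / ‖p.1‖ ^ 2}

/-- `X = x ∂/∂x + y ∂/∂y`. -/
def fieldX (p : ℂ × ℝ × ℝ) : ℂ × ℝ × ℝ := (p.1, 0, 0)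

/-- `Y = x ∂/∂y - y ∂/∂x - 2|z|² ∂/∂t`. -/
def fieldY (p : ℂ × ℝ × ℝ) : ℂ × ℝ × ℝ := (Complex.I * p.1, -2 * ‖p.1‖ ^ 2, 0)

/-- The Reeb field `T = x ∂/∂y - y ∂/∂x`. -/
def fieldT (p : ℂ × ℝ × ℝ) : ℂ × ℝ × ℝ := (Complex.I * p.1, 0, 0)

/-- `S = r ∂/∂r`. -/
def fieldS (p : ℂ × ℝ × ℝ) : ℂ × ℝ × ℝ := (0, 0, p.2.2)

/-- The form `φ⋆ = d(|z|²) / (2|z|²)`. -/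
def formPhi (p v : ℂ × ℝ × ℝ) : ℝ := (star p.1 * v.1).re / ‖p.1‖ ^ 2

/-- The form `ψ⋆ = - dt / (2|z|²)`. -/
def formPsi (p v : ℂ × ℝ × ℝ) : ℝ := -v.2.1 / (2 * ‖p.1‖ ^ 2)

/-- The contact form `ω⋆ = dt / (2|z|²) + d arg z`. -/
def formOmega (p v : ℂ × ℝ × ℝ) : ℝ :=
  v.2.1 / (2 * ‖p.1‖ ^ 2) + (star p.1 * v.1).im / ‖p.1‖ ^ 2

/-- The (almost) complex structure `𝕁` of the cone, at the point `p`: in the frame `X, Y, T, S`,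
whose dual frame is `φ⋆, ψ⋆, ω⋆, dr/r`, it is given by
`𝕁 X = Y`, `𝕁 Y = -X`, `𝕁 T = -S`, `𝕁 S = T`. -/
def coneJ (p v : ℂ × ℝ × ℝ) : ℂ × ℝ × ℝ :=
  formPhi p v • fieldY p - formPsi p v • fieldX p - formOmega p v • fieldS p
    + (v.2.2 / p.2.2) • fieldT p

/-- The horizontal bundle `H⋆ = ⟨X, Y⟩` at the point `p`. -/
def coneH (p : ℂ × ℝ × ℝ) : Submodule ℝ (ℂ × ℝ × ℝ) :=
  Submodule.span ℝ {fieldX p, fieldY p}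

theorem star_mul_self_re (z : ℂ) : (star z * z).re = ‖z‖ ^ 2 := by
  rw [← Complex.normSq_eq_norm_sq, Complex.normSq_apply]; simp

theorem star_mul_self_im (z : ℂ) : (star z * z).im = 0 := by
  simp; ring

theorem star_mul_I_re (z : ℂ) : (star z * (Complex.I * z)).re = 0 := by
  simp; ring

theorem star_mul_I_im (z : ℂ) : (star z * (Complex.I * z)).im = ‖z‖ ^ 2 := by
  rw [← Complex.normSq_eq_norm_sq, Complex.normSq_apply]; simp

theorem coneJ_X {p : ℂ × ℝ × ℝ} (hp : p.1 ≠ 0) : coneJ p (fieldX p) = fieldY p := by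
  have h : ‖p.1‖ ^ 2 ≠ 0 := pow_ne_zero 2 (norm_ne_zero_iff.mpr hp)
  have h1 : formPhi p (fieldX p) = 1 := by
    simp only [formPhi, fieldX, star_mul_self_re]; exact div_self h
  have h2 : formPsi p (fieldX p) = 0 := by simp [formPsi, fieldX]
  have h3 : formOmega p (fieldX p) = 0 := by
    simp only [formOmega, fieldX, star_mul_self_im]; simp
  rw [coneJ, h1, h2, h3]
  simp [fieldX]

theorem coneJ_Y {p : ℂ × ℝ × ℝ} (hp : p.1 ≠ 0) : coneJ p (fieldY p) = -fieldX p := by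
  have h : ‖p.1‖ ^ 2 ≠ 0 := pow_ne_zero 2 (norm_ne_zero_iff.mpr hp)
  have h1 : formPhi p (fieldY p) = 0 := by
    simp only [formPhi, fieldY, star_mul_I_re]; simp
  have h2 : formPsi p (fieldY p) = 1 := by simp only [formPsi, fieldY]; field_simp
  have h3 : formOmega p (fieldY p) = 0 := by
    simp only [formOmega, fieldY, star_mul_I_im]; field_simp; ring
  rw [coneJ, h1, h2, h3]
  simp [fieldY]

theorem coneJ_T {p : ℂ × ℝ × ℝ} (hp : p.1 ≠ 0) : coneJ p (fieldT p) = -fieldS p := by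
  have h : ‖p.1‖ ^ 2 ≠ 0 := pow_ne_zero 2 (norm_ne_zero_iff.mpr hp)
  have h1 : formPhi p (fieldT p) = 0 := by
    simp only [formPhi, fieldT, star_mul_I_re]; simp
  have h2 : formPsi p (fieldT p) = 0 := by simp [formPsi, fieldT]
  have h3 : formOmega p (fieldT p) = 1 := by
    simp only [formOmega, fieldT, star_mul_I_im]; field_simp; ring
  rw [coneJ, h1, h2, h3]
  simp [fieldT]

theorem coneJ_S {p : ℂ × ℝ × ℝ} (hr : p.2.2 ≠ 0) : coneJ p (fieldS p) = fieldT p := by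
  simp [coneJ, formPhi, formPsi, formOmega, fieldS, fieldT, hr]

/-! ### Complex structures on a set -/

/-- A structure of two-dimensional complex manifold on the set `X`: a Hausdorff second countable
topology and an atlas of charts in `ℂ × ℂ` with holomorphic transition maps. -/
structure ComplexStructure (X : Type) where
  [top : TopologicalSpace X]
  [t2 : T2Space X]
  [secondCountable : SecondCountableTopology X]
  [charts : ChartedSpace (ℂ × ℂ) X]
  [holo : IsManifold 𝓘(ℂ, ℂ × ℂ) ω X]

namespace ComplexStructure

variable {X : Type}

/-- The complex manifold whose underlying set is `X`, with the structure `M`. -/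
def Space (_M : ComplexStructure X) : Type := X

instance (M : ComplexStructure X) : TopologicalSpace M.Space := M.top
instance (M : ComplexStructure X) : ChartedSpace (ℂ × ℂ) M.Space := M.charts

/-- The identity map of `X`, as a map from the manifold `(X, M)` to the manifold `(X, N)`. -/
def idMap (M N : ComplexStructure X) : M.Space → N.Space := fun x : X => x

/-- A map `f : X → E`, as a map on the manifold `(X, M)`. -/
def onSpace {E : Type} (M : ComplexStructure X) (f : X → E) : M.Space → E := f

/-- The real differential at `x` of a map from the manifold `(X, M)` to a real vector space.
The real tangent space of `(X, M)` at `x` is `ℂ × ℂ`, through the preferred holomorphic chart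
at `x`, and its complex structure is the multiplication by `i`. -/
def dVec {E : Type} [NormedAddCommGroup E] [NormedSpace ℝ E] (M : ComplexStructure X)
    (f : M.Space → E) (x : M.Space) : (ℂ × ℂ) →L[ℝ] E :=
  mfderiv 𝓘(ℝ, ℂ × ℂ) 𝓘(ℝ, E) f x

/-- The real differential at `x` of a map from `(X, M)` to `(X, N)`. -/
def dMap (M N : ComplexStructure X) (f : M.Space → N.Space) (x : M.Space) :
    (ℂ × ℂ) →L[ℝ] (ℂ × ℂ) :=
  mfderiv 𝓘(ℝ, ℂ × ℂ) 𝓘(ℝ, ℂ × ℂ) f x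

/-- `f` is a biholomorphism from `(X, M)` onto the subset `U` of the real vector space `E`
equipped with the almost complex structure `J`: it is a smooth diffeomorphism onto `U` whose
differential satisfies `df (i v) = J (df v)`. In other words, `M` is the pull-back by `f` of the
complex structure `J` of `U`. -/
def IsBiholomorphicOnto {E : Type} [NormedAddCommGroup E] [NormedSpace ℝ E]
    (M : ComplexStructure X) (f : X → E) (U : Set E) (J : E → E → E) : Prop :=
  IsOpen U ∧ Set.BijOn f Set.univ U ∧
    ContMDiff 𝓘(ℝ, ℂ × ℂ) 𝓘(ℝ, E) ∞ (M.onSpace f) ∧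
    (∃ g : E → M.Space, Function.LeftInverse g (M.onSpace f) ∧
      ContMDiffOn 𝓘(ℝ, E) 𝓘(ℝ, ℂ × ℂ) ∞ g U) ∧
    ∀ (x : M.Space) (v : ℂ × ℂ),
      M.dVec (M.onSpace f) x (Complex.I • v) =
        J (M.onSpace f x) (M.dVec (M.onSpace f) x v)

/-- The identity map is a smooth (real) diffeomorphism from `(X, M)` to `(X, N)`. -/
def IdIsDiffeo (M N : ComplexStructure X) : Prop :=
  ContMDiff 𝓘(ℝ, ℂ × ℂ) 𝓘(ℝ, ℂ × ℂ) ∞ (idMap M N) ∧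
    ContMDiff 𝓘(ℝ, ℂ × ℂ) 𝓘(ℝ, ℂ × ℂ) ∞ (idMap N M)

/-- The identity map is biholomorphic from `(X, M)` to `(X, N)`. -/
def IdIsBiholomorphic (M N : ComplexStructure X) : Prop :=
  MDifferentiable 𝓘(ℂ, ℂ × ℂ) 𝓘(ℂ, ℂ × ℂ) (idMap M N) ∧
    MDifferentiable 𝓘(ℂ, ℂ × ℂ) 𝓘(ℂ, ℂ × ℂ) (idMap N M)

/-- The distribution `H` of real subspaces of the tangent spaces of `(X, M)` consists of complex
lines, so that `H`, with the multiplication by `i`, is a CR structure of codimension two.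
(For such a distribution of rank two, formal integrability is automatic.) -/
def IsComplexLineField (M : ComplexStructure X) (H : M.Space → Submodule ℝ (ℂ × ℂ)) : Prop :=
  ∀ x, Module.finrank ℝ (H x) = 2 ∧ ∀ v ∈ H x, Complex.I • v ∈ H x

/-- The map `f` from `(X, M)` to `(X, N)` is CR with respect to the distributions `H` and `H'`:
its differential maps `H` to `H'` and commutes with the complex structures on `H`. -/
def IsCR (M N : ComplexStructure X) (f : M.Space → N.Space)
    (H : M.Space → Submodule ℝ (ℂ × ℂ)) (H' : N.Space → Submodule ℝ (ℂ × ℂ)) : Prop :=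
  ContMDiff 𝓘(ℝ, ℂ × ℂ) 𝓘(ℝ, ℂ × ℂ) ∞ f ∧
    ∀ (x : M.Space), ∀ v ∈ H x, dMap M N f x v ∈ H' (f x) ∧
      dMap M N f x (Complex.I • v) = Complex.I • dMap M N f x v

end ComplexStructure

/-- The subbundle `H` of the tangent bundle of `F₄''` corresponding to `H⋆ = ⟨X, Y⟩` through
`B₀`: the vectors `v` such that `dB₀ (v) ∈ H⋆`. -/
def horizontal (M : ComplexStructure F4'') (x : M.Space) : Submodule ℝ (ℂ × ℂ) :=
  (coneH (M.onSpace B0 x)).comap (M.dVec (M.onSpace B0) x).toLinearMap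

end FourPoints

end

noncomputable section

namespace FourPoints

/-! ### The boundary and the action of `PU(2,1)` -/

/-! The group acts transitively on ordered pairs of distinct boundary points
(`exists_PU21_normalise`), and the elements fixing `∞` and `(0,0)` are exactly the maps `(z,t) ↦
(cz,|c|²t)` (`exists_dilation`, `eq_dilation_of_stabiliser`). Moving `p₂, p₃` to these two points
leaves only `c` free. The first collinearity condition says that `p₁` has nonzero `z`-coordinate, so
`c` is fixed by making it `1`; the second says `z ≠ 0` for `p₄`; the orbit condition says `t ≠ |z|²
tan a` (`normalQuad_mem_C4''_iff`). With `log r = tan a` this is the definition of `cone'`, so `B0`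
is a bijection.

The rest is calculus with two global charts. The map `(z,t,r) ↦ (rz, |z|² - it)` is holomorphic for
`𝕁` (`fderiv_coneChart_coneJ`), so composed with `B0` it gives a chart defining `M₀`; `B1` itself is
a chart defining `M₁`. The passage from `B0` to `B1` is `compare`, which has an explicit smooth
inverse, so the identity is a diffeomorphism.

Along `X` and `Y` the coordinate `r` is constant, and both `z` and `|z|² - it` have `Y`-derivative
equal to `i` times the `X`-derivative; dividing by the constant `1 - i log r` preserves this, whence
the CR property (`coneJ_mem_coneH`). Transversally it fails: `S` kills `z`, whereas `𝕁 S = T`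
rotates it, so the first coordinate of `B1` is nowhere `𝕁`-holomorphic (`not_idIsBiholomorphic`). -/

theorem herm_add_left (u v w : Fin 3 → ℂ) : herm (u + v) w = herm u w + herm v w := by
  simp only [herm, Pi.add_apply]; ring

theorem herm_smul_left (c : ℂ) (u w : Fin 3 → ℂ) : herm (c • u) w = c * herm u w := by
  simp only [herm, Pi.smul_apply, smul_eq_mul]; ring

theorem star_herm (u w : Fin 3 → ℂ) : star (herm u w) = herm w u := by
  simp only [herm, star_add, star_mul', star_star]; ring

theorem herm_add_right (u v w : Fin 3 → ℂ) : herm w (u + v) = herm w u + herm w v := by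
  rw [← star_herm, herm_add_left, star_add, star_herm, star_herm]

theorem herm_smul_right (c : ℂ) (u w : Fin 3 → ℂ) : herm w (c • u) = star c * herm w u := by
  rw [← star_herm, herm_smul_left, star_mul', star_herm]

theorem mk_mem_boundary {v : Fin 3 → ℂ} (hv : v ≠ 0) :
    Projectivization.mk ℂ v hv ∈ boundary ↔ herm v v = 0 := by
  simp only [boundary, Set.mem_ofPred_eq, Projectivization.submodule_mk,
    Submodule.mem_span_singleton]
  constructor
  · intro h
    exact h v ⟨1, one_smul _ _⟩
  · rintro h _ ⟨c, rfl⟩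
    rw [herm_smul_left, herm_smul_right, h]; simp

theorem mk_submodule_le {v : Fin 3 → ℂ} (hv : v ≠ 0) (W : Submodule ℂ (Fin 3 → ℂ)) :
    (Projectivization.mk ℂ v hv).submodule ≤ W ↔ v ∈ W := by
  rw [Projectivization.submodule_mk, Submodule.span_singleton_le_iff_mem]

theorem mem_PU21 {g : Equiv.Perm (ℙ ℂ (Fin 3 → ℂ))} :
    g ∈ PU21 ↔ ∃ u : (Fin 3 → ℂ) ≃ₗ[ℂ] (Fin 3 → ℂ), (∀ z w, herm (u z) (u w) = herm z w) ∧
      ∀ (v : Fin 3 → ℂ) (hv : v ≠ 0), g (Projectivization.mk ℂ v hv) =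
        Projectivization.mk ℂ (u v) ((LinearEquiv.map_ne_zero_iff u).mpr hv) := by
  constructor
  · rintro ⟨u, hu, rfl⟩
    exact ⟨u, hu, fun v hv => rfl⟩
  · rintro ⟨u, hu, h⟩
    refine ⟨u, hu, ?_⟩
    ext p
    induction p using Projectivization.ind with
    | h v hv => rw [h]; rfl

/-- The form is nondegenerate, so preserving it forces injectivity, hence invertibility in finite
dimension. Elements of the group can thus be given by explicit linear maps without exhibiting
inverses. -/
theorem exists_PU21_of_isometry (f : (Fin 3 → ℂ) →ₗ[ℂ] (Fin 3 → ℂ))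
    (hf : ∀ z w, herm (f z) (f w) = herm z w) :
    ∃ g ∈ PU21, ∀ (v : Fin 3 → ℂ) (hv : v ≠ 0) (hfv : f v ≠ 0),
      g (Projectivization.mk ℂ v hv) = Projectivization.mk ℂ (f v) hfv := by
  have hinj : Function.Injective f := by
    rw [injective_iff_map_eq_zero]
    intro z hz
    have h : ∀ w, herm z w = 0 := fun w => by rw [← hf, hz]; simp [herm]
    have h0 := h ![0, 0, 1]
    have h1 := h ![0, 1, 0]
    have h2 := h ![1, 0, 0]
    simp [herm] at h0 h1 h2
    ext i; fin_cases i <;> simp [h0, h1, h2]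
  let u := LinearEquiv.ofInjectiveEndo f hinj
  refine ⟨MulAction.toPermHom _ _ u, ⟨u, fun z w => hf z w, rfl⟩, fun v hv hfv => rfl⟩

theorem PU21_mem_boundary {g : Equiv.Perm (ℙ ℂ (Fin 3 → ℂ))} (hg : g ∈ PU21)
    {p : ℙ ℂ (Fin 3 → ℂ)} (hp : p ∈ boundary) : g p ∈ boundary := by
  obtain ⟨u, hu, h⟩ := mem_PU21.1 hg
  induction p using Projectivization.ind with
  | h v hv => rw [h, mk_mem_boundary, hu]; exact (mk_mem_boundary hv).1 hp

theorem IsCCircle.exists_image {S : Set (ℙ ℂ (Fin 3 → ℂ))} (hS : IsCCircle S)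
    {g : Equiv.Perm (ℙ ℂ (Fin 3 → ℂ))} (hg : g ∈ PU21) :
    ∃ S', IsCCircle S' ∧ ∀ p ∈ S, g p ∈ S' := by
  obtain ⟨W, hW, ⟨v, hvW, hv⟩, rfl⟩ := hS
  obtain ⟨u, hu, h⟩ := mem_PU21.1 hg
  refine ⟨_, ⟨W.map u.toLinearMap, ?_, ⟨u v, ⟨v, hvW, rfl⟩, by rwa [hu]⟩, rfl⟩, ?_⟩
  · rw [← hW]; exact LinearEquiv.finrank_map_eq u W
  · rintro p ⟨hp, hpW⟩
    refine ⟨PU21_mem_boundary hg hp, ?_⟩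
    induction p using Projectivization.ind with
    | h w hw =>
      rw [h, mk_submodule_le]
      exact ⟨w, (mk_submodule_le hw W).1 hpW, rfl⟩

theorem C4_smul {p : Fin 4 → ℙ ℂ (Fin 3 → ℂ)} (hp : p ∈ C4) (g : PU21) : g • p ∈ C4 :=
  ⟨fun _ _ h => hp.1 (g.1.injective h), fun i => PU21_mem_boundary g.2 (hp.2 i)⟩

/-- A forbidden configuration of the translated quadruple is carried back by `g⁻¹`; in the orbit
condition the stabilising element is conjugated. This lets the conditions, required in `F4''` of
some representative only, pass to the normalised one. -/
theorem C4''_smul {p : Fin 4 → ℙ ℂ (Fin 3 → ℂ)} (hp : p ∈ C4'') (g : PU21) : g • p ∈ C4'' := by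
  obtain ⟨h0, h1, h2, h3⟩ := hp
  have key : ∀ i, g.1⁻¹ ((g • p) i) = p i := fun i => g.1.symm_apply_apply (p i)
  have hginv : g.1⁻¹ ∈ PU21 := PU21.inv_mem g.2
  refine ⟨C4_smul h0 g, ?_, ?_, ?_⟩
  · rintro ⟨S, hS, ha, hb, hc⟩
    obtain ⟨S', hS', h⟩ := hS.exists_image hginv
    exact h1 ⟨S', hS', key 0 ▸ h _ ha, key 1 ▸ h _ hb, key 2 ▸ h _ hc⟩
  · rintro ⟨S, hS, ha, hb, hc⟩
    obtain ⟨S', hS', h⟩ := hS.exists_image hginv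
    exact h2 ⟨S', hS', key 1 ▸ h _ ha, key 2 ▸ h _ hb, key 3 ▸ h _ hc⟩
  · rintro ⟨k, hk, ha, hb, hc⟩
    have hmul (i j) (h : k ((g • p) i) = (g • p) j) : (g.1⁻¹ * k * g.1) (p i) = p j := by
      rw [← key j, ← h]; rfl
    exact h3 ⟨g.1⁻¹ * k * g.1, PU21.mul_mem (PU21.mul_mem hginv hk) g.2,
      hmul _ _ ha, hmul _ _ hb, hmul _ _ hc⟩

/-! ### Heisenberg coordinates -/

/-- The standard lift of the boundary point with Heisenberg coordinates `(z, t)`. -/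
def heisVec (z : ℂ) (t : ℝ) : Fin 3 → ℂ :=
  ![-((‖z‖ ^ 2 : ℝ) : ℂ) + Complex.I * t, (Real.sqrt 2 : ℂ) * z, 1]

theorem heisVec_ne_zero (z : ℂ) (t : ℝ) : heisVec z t ≠ 0 :=
  fun h => one_ne_zero (congrFun h 2)

theorem heis_eq_mk (z : ℂ) (t : ℝ) :
    heis z t = Projectivization.mk ℂ (heisVec z t) (heisVec_ne_zero z t) := rfl

theorem sqrt_two_mul_self : ((Real.sqrt 2 : ℝ) : ℂ) * (Real.sqrt 2 : ℝ) = 2 := by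
  rw [← Complex.ofReal_mul, Real.mul_self_sqrt (by norm_num)]; simp

theorem sqrt_two_ne_zero : ((Real.sqrt 2 : ℝ) : ℂ) ≠ 0 := by
  intro h
  have := sqrt_two_mul_self
  rw [h] at this; norm_num at this

theorem mul_star_eq_norm_sq (z : ℂ) : z * star z = ((‖z‖ ^ 2 : ℝ) : ℂ) := by
  rw [← Complex.normSq_eq_norm_sq]; exact Complex.mul_conj z

theorem heis_mem_boundary (z : ℂ) (t : ℝ) : heis z t ∈ boundary := by
  rw [heis_eq_mk, mk_mem_boundary]
  have h := mul_star_eq_norm_sq z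
  simp [herm, heisVec] at h ⊢
  linear_combination 2 * h + z * (starRingEnd ℂ z) * sqrt_two_mul_self

theorem infty_mem_boundary : infty ∈ boundary := by
  rw [infty, mk_mem_boundary]; simp [herm]

theorem heis_ne_infty (z : ℂ) (t : ℝ) : heis z t ≠ infty := by
  rw [heis_eq_mk, infty, Ne, Projectivization.mk_eq_mk_iff']
  rintro ⟨a, ha⟩
  have := congrFun ha 2
  simp [heisVec] at this

theorem heis_injective {z z' : ℂ} {t t' : ℝ} (h : heis z t = heis z' t') : z = z' ∧ t = t' := by
  rw [heis_eq_mk, heis_eq_mk, Projectivization.mk_eq_mk_iff'] at h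
  obtain ⟨a, ha⟩ := h
  have h2 := congrFun ha 2
  have h1 := congrFun ha 1
  have h0 := congrFun ha 0
  simp [heisVec] at h2
  subst h2
  simp [heisVec] at h1
  have hz : z = z' := h1.symm
  subst hz
  simp [heisVec] at h0
  exact ⟨rfl, h0.symm⟩

/-- If the last coordinate vanishes, nullity kills the middle one. Otherwise rescale the last
coordinate to `1`: nullity then fixes the real part of the first coordinate as `-|z|²`, and its
imaginary part is the free parameter `t`. -/
theorem eq_infty_or_heis {p : ℙ ℂ (Fin 3 → ℂ)} (hp : p ∈ boundary) :
    p = infty ∨ ∃ z t, p = heis z t := by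
  induction p using Projectivization.ind with
  | h v hv =>
  rw [mk_mem_boundary] at hp
  by_cases h2 : v 2 = 0
  · left
    have h1 : v 1 = 0 := by simpa [herm, h2] using hp
    rw [infty, Projectivization.mk_eq_mk_iff']
    refine ⟨v 0, ?_⟩
    ext i; fin_cases i <;> simp [h1, h2]
  · right
    have hs := sqrt_two_ne_zero
    refine ⟨v 1 / (v 2 * (Real.sqrt 2 : ℝ)), (v 0 / v 2).im, ?_⟩
    rw [heis_eq_mk, Projectivization.mk_eq_mk_iff']
    refine ⟨v 2, ?_⟩
    have h0 : v 0 = v 2 * (-((‖v 1 / (v 2 * (Real.sqrt 2 : ℝ))‖ ^ 2 : ℝ) : ℂ)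
        + Complex.I * (v 0 / v 2).im) := by
      rw [← mul_star_eq_norm_sq]
      have hi : Complex.I * ((v 0 / v 2).im : ℂ) = (v 0 / v 2 - star (v 0 / v 2)) / 2 := by
        have := Complex.sub_conj (v 0 / v 2)
        rw [starRingEnd_apply] at this
        rw [this]; push_cast; ring
      rw [hi]
      have h2' : star (v 2) ≠ 0 := by simpa using h2
      simp only [herm] at hp
      have hss : star ((Real.sqrt 2 : ℝ) : ℂ) = ((Real.sqrt 2 : ℝ) : ℂ) := Complex.conj_ofReal _
      simp only [star_div₀, star_mul', hss]
      have hsq := sqrt_two_mul_self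
      have : v 1 / (v 2 * (Real.sqrt 2 : ℝ)) * (star (v 1) / (star (v 2) * (Real.sqrt 2 : ℝ)))
          = v 1 * star (v 1) / (v 2 * star (v 2) * 2) := by
        rw [div_mul_div_comm, ← hsq]; ring
      rw [this]
      field_simp
      linear_combination hp
    ext i; fin_cases i
    · simpa [heisVec] using h0.symm
    · simp [heisVec]; field_simp
    · simp [heisVec]

/-- The lifts of `∞` and `(0,0)` span the plane where the middle coordinate vanishes, and a third
lift with `z ≠ 0` completes them to a basis of `ℂ³`. -/
theorem coll_iff (z : ℂ) (t : ℝ) :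
    (∃ S, IsCCircle S ∧ infty ∈ S ∧ heis 0 0 ∈ S ∧ heis z t ∈ S) ↔ z = 0 := by
  have e0 : (![1, 0, 0] : Fin 3 → ℂ) ≠ 0 := fun h => one_ne_zero (congrFun h 0)
  constructor
  · rintro ⟨_, ⟨W, hW, -, rfl⟩, ⟨-, h1⟩, ⟨-, h2⟩, ⟨-, h3⟩⟩
    by_contra hz
    rw [infty, mk_submodule_le] at h1
    rw [heis_eq_mk, mk_submodule_le] at h2 h3
    have htop : W = ⊤ := by
      rw [eq_top_iff]
      intro v _
      have : v = (v 0 - (v 1 / ((Real.sqrt 2 : ℝ) * z)) * heisVec z t 0) • ![1, 0, 0]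
          + (v 2 - v 1 / ((Real.sqrt 2 : ℝ) * z)) • heisVec 0 0
          + (v 1 / ((Real.sqrt 2 : ℝ) * z)) • heisVec z t := by
        have hs := sqrt_two_ne_zero
        ext i; fin_cases i
        · simp [heisVec]
        · simp [heisVec]; field_simp
        · simp [heisVec]
      rw [this]
      exact W.add_mem (W.add_mem (W.smul_mem _ h1) (W.smul_mem _ h2)) (W.smul_mem _ h3)
    rw [htop, finrank_top] at hW
    simp at hW
  · rintro rfl
    have hli : LinearIndependent ℂ ![(![1, 0, 0] : Fin 3 → ℂ), heisVec 0 0] := by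
      rw [LinearIndependent.pair_iff]
      intro a b h
      have h0 := congrFun h 0
      have h2 := congrFun h 2
      simp [heisVec] at h0 h2
      exact ⟨h0, h2⟩
    have m1 : (![1, 0, 0] : Fin 3 → ℂ) ∈
        Submodule.span ℂ (Set.range ![(![1, 0, 0] : Fin 3 → ℂ), heisVec 0 0]) :=
      Submodule.subset_span ⟨0, rfl⟩
    have m2 : heisVec 0 0 ∈
        Submodule.span ℂ (Set.range ![(![1, 0, 0] : Fin 3 → ℂ), heisVec 0 0]) :=
      Submodule.subset_span ⟨1, rfl⟩
    refine ⟨_, ⟨Submodule.span ℂ (Set.range ![![1, 0, 0], heisVec 0 0]), ?_,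
      -- The difference of the two null lifts has norm `-2`, so this plane does meet the complex
      -- hyperbolic plane.
      ⟨![1, 0, 0] + (-1 : ℂ) • heisVec 0 0,
        Submodule.add_mem _ m1 (Submodule.smul_mem _ _ m2), ?_⟩, rfl⟩, ?_, ?_, ?_⟩
    · rw [finrank_span_eq_card hli]; simp
    · simp [herm, heisVec]
    · exact ⟨infty_mem_boundary, (mk_submodule_le _ _).2 m1⟩
    · exact ⟨heis_mem_boundary _ _, (mk_submodule_le _ _).2 m2⟩
    · refine ⟨heis_mem_boundary _ _, (mk_submodule_le _ _).2 ?_⟩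
      have : heisVec 0 t = (Complex.I * t) • ![1, 0, 0] + heisVec 0 0 := by
        ext i; fin_cases i <;> simp [heisVec]
      change heisVec 0 t ∈ _
      rw [this]
      exact Submodule.add_mem _ (Submodule.smul_mem _ _ m1) m2

/-! ### Stabilisers of the two points `∞` and `(0, 0)` -/

theorem exists_dilation {c : ℂ} (hc : c ≠ 0) :
    ∃ g ∈ PU21, g infty = infty ∧ ∀ z t, g (heis z t) = heis (c * z) (‖c‖ ^ 2 * t) := by
  have hn : (‖c‖ : ℂ) ≠ 0 := by simpa using hc
  have hcc := mul_star_eq_norm_sq c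
  obtain ⟨g, hg, h⟩ := exists_PU21_of_isometry
    (Matrix.toLin' (Matrix.diagonal ![(‖c‖ : ℂ), c / ‖c‖, (‖c‖ : ℂ)⁻¹])) (by
      intro z w
      simp only [Matrix.toLin'_apply, herm, Matrix.mulVec_diagonal]
      simp only [Matrix.cons_val, star_mul', star_div₀, star_inv₀]
      have hs : star (‖c‖ : ℂ) = ‖c‖ := Complex.conj_ofReal _
      rw [hs]
      field_simp
      push_cast at hcc
      linear_combination (z 1 * star (w 1)) * hcc)
  refine ⟨g, hg, ?_, fun z t => ?_⟩
  · have hv : (![1, 0, 0] : Fin 3 → ℂ) ≠ 0 := fun h => one_ne_zero (congrFun h 0)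
    have e : Matrix.toLin' (Matrix.diagonal ![(‖c‖ : ℂ), c / ‖c‖, (‖c‖ : ℂ)⁻¹]) ![1, 0, 0]
        = (‖c‖ : ℂ) • ![1, 0, 0] := by
      rw [Matrix.toLin'_apply]
      ext i; fin_cases i <;> simp [Matrix.mulVec_diagonal]
    rw [infty, h _ _ (by rw [e]; exact smul_ne_zero hn hv), Projectivization.mk_eq_mk_iff']
    exact ⟨_, e.symm⟩
  · have e : Matrix.toLin' (Matrix.diagonal ![(‖c‖ : ℂ), c / ‖c‖, (‖c‖ : ℂ)⁻¹]) (heisVec z t)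
        = (‖c‖ : ℂ)⁻¹ • heisVec (c * z) (‖c‖ ^ 2 * t) := by
      rw [Matrix.toLin'_apply]
      ext i; fin_cases i <;> simp [Matrix.mulVec_diagonal, heisVec] <;> field_simp
    rw [heis_eq_mk, heis_eq_mk, h _ (heisVec_ne_zero z t) (by
      rw [e]; exact smul_ne_zero (inv_ne_zero hn) (heisVec_ne_zero _ _))]
    refine (Projectivization.mk_eq_mk_iff' _ _ _ _ _).2 ?_
    exact ⟨_, e.symm⟩

/-- A lift scales the two null vectors by `a` and `b` with `a b̄ = 1`. The image `e` of the middle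
basis vector is orthogonal to both of them, hence stays on the middle axis with a coefficient of
modulus one. The lift is therefore diagonal. -/
theorem eq_dilation_of_stabiliser {g : Equiv.Perm (ℙ ℂ (Fin 3 → ℂ))} (hg : g ∈ PU21)
    (h1 : g infty = infty) (h2 : g (heis 0 0) = heis 0 0) :
    ∃ c : ℂ, ∀ z t, g (heis z t) = heis (c * z) (‖c‖ ^ 2 * t) := by
  obtain ⟨u, hu, h⟩ := mem_PU21.1 hg
  rw [infty, h, Projectivization.mk_eq_mk_iff'] at h1
  rw [heis_eq_mk, h, Projectivization.mk_eq_mk_iff'] at h2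
  obtain ⟨a, ha⟩ := h1
  obtain ⟨b, hb⟩ := h2
  have hz : heisVec 0 0 = ![0, 0, 1] := by ext i; fin_cases i <;> simp [heisVec]
  rw [hz] at hb
  set e := u ![0, 1, 0] with he
  have hab := hu ![1, 0, 0] ![0, 0, 1]
  have he0 := hu ![0, 1, 0] ![0, 0, 1]
  have he2 := hu ![0, 1, 0] ![1, 0, 0]
  have hee := hu ![0, 1, 0] ![0, 1, 0]
  rw [← ha, ← hb] at hab
  rw [← hb, ← he] at he0
  rw [← ha, ← he] at he2
  rw [← he] at hee
  simp [herm] at hab he0 he2 hee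
  have hb0 : b ≠ 0 := by rintro rfl; simp at hab
  have ha0 : a ≠ 0 := by rintro rfl; simp at hab
  have e0 : e 0 = 0 := by simpa [hb0] using he0
  have e2 : e 2 = 0 := by simpa [ha0] using he2
  rw [e0, e2] at hee
  simp at hee
  clear_value e
  -- Dividing by `b` restores last coordinate `1`; since `|e 1| = 1` and `a b̄ = 1`, the first
  -- coordinate gets the factor `a / b = |c|²`.
  refine ⟨e 1 / b, fun z t => ?_⟩
  rw [heis_eq_mk, heis_eq_mk, h, Projectivization.mk_eq_mk_iff']
  refine ⟨b, ?_⟩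
  have huv : u (heisVec z t) = heisVec z t 0 • (a • ![1, 0, 0]) + heisVec z t 1 • e
      + heisVec z t 2 • (b • ![0, 0, 1]) := by
    rw [ha, hb, he, ← map_smul, ← map_smul, ← map_smul, ← map_add, ← map_add]
    congr 1
    ext i; fin_cases i <;> simp
  rw [huv]
  have hn : b * ((‖e 1 / b‖ ^ 2 : ℝ) : ℂ) = a := by
    rw [← mul_star_eq_norm_sq]
    have hb0' : (starRingEnd ℂ) b ≠ 0 := by simpa using hb0
    simp
    field_simp
    linear_combination hee - hab
  have hn' : ((‖e 1‖ : ℂ) ^ 2 / (‖b‖ : ℂ) ^ 2) * b = a := by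
    rw [← hn]; push_cast; rw [norm_div]; push_cast; ring
  obtain ⟨x, rfl⟩ : ∃ x, e = ![0, x, 0] :=
    ⟨e 1, by ext i; fin_cases i <;> simp [e0, e2]⟩
  simp at hn'
  ext i; fin_cases i
  · simp [heisVec, ← hn']
    ring
  · simp [heisVec]
    field_simp
  · simp [heisVec]

/-- In signature `(2,1)` there is no totally isotropic plane. Concretely, for two standard lifts the
form has real part `-|z - z'|²`, and imaginary part `t - t'` once `z = z'`. -/
theorem herm_ne_zero {v w : Fin 3 → ℂ} (hv : v ≠ 0) (hw : w ≠ 0) (hvv : herm v v = 0)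
    (hww : herm w w = 0)
    (h : Projectivization.mk ℂ v hv ≠ Projectivization.mk ℂ w hw) : herm v w ≠ 0 := by
  intro hvw
  rcases eq_infty_or_heis ((mk_mem_boundary hv).2 hvv) with h1 | ⟨z, t, h1⟩ <;>
  rcases eq_infty_or_heis ((mk_mem_boundary hw).2 hww) with h2 | ⟨z', t', h2⟩
  · exact h (h1.trans h2.symm)
  all_goals
    have h1' := h1
    have h2' := h2
    simp only [infty, heis_eq_mk, Projectivization.mk_eq_mk_iff'] at h1 h2
    obtain ⟨a, rfl⟩ := h1
    obtain ⟨b, rfl⟩ := h2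
    have ha : a ≠ 0 := by rintro rfl; simp at hv
    have hb : b ≠ 0 := by rintro rfl; simp at hw
    rw [herm_smul_left, herm_smul_right] at hvw
    simp [ha, hb] at hvw
  · simp [herm, heisVec] at hvw
  · simp [herm, heisVec] at hvw
  · apply h
    rw [h1', h2']
    have hre := congrArg Complex.re hvw
    have him := congrArg Complex.im hvw
    have hs : Real.sqrt 2 * Real.sqrt 2 = 2 := Real.mul_self_sqrt (by norm_num)
    simp [herm, heisVec, ← Complex.normSq_eq_norm_sq, Complex.normSq_apply,
      -Complex.ofReal_add, -Complex.ofReal_mul] at hre him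
    have hd : (z.re - z'.re) ^ 2 + (z.im - z'.im) ^ 2 = 0 := by
      linear_combination -hre + (z.re * z'.re + z.im * z'.im) * hs
    have r : z.re = z'.re := by nlinarith [sq_nonneg (z.re - z'.re), sq_nonneg (z.im - z'.im)]
    have i : z.im = z'.im := by nlinarith [sq_nonneg (z.re - z'.re), sq_nonneg (z.im - z'.im)]
    have hz : z = z' := Complex.ext r i
    subst hz
    have : t = t' := by linear_combination him
    rw [this]

/-- The two null vectors are completed to a basis with the Gram matrix of the standard one. The
change of basis is then an isometry taking `∞` and `(0,0)` to the given points, and its inverse is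
the required element. -/
theorem exists_PU21_normalise {p q : ℙ ℂ (Fin 3 → ℂ)} (hp : p ∈ boundary) (hq : q ∈ boundary)
    (hpq : p ≠ q) : ∃ g ∈ PU21, g p = infty ∧ g q = heis 0 0 := by
  induction p using Projectivization.ind with
  | h v hv =>
  induction q using Projectivization.ind with
  | h w' hw' =>
  have hvv := (mk_mem_boundary hv).1 hp
  have hww' := (mk_mem_boundary hw').1 hq
  have hne := herm_ne_zero hv hw' hvv hww' hpq
  obtain ⟨c, hc, w, rfl, hvw⟩ : ∃ c : ℂ, c ≠ 0 ∧ ∃ w, c • w = w' ∧ herm v w = 1 := by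
    refine ⟨star (herm v w'), by simpa using hne, (star (herm v w'))⁻¹ • w', ?_, ?_⟩
    · rw [smul_inv_smul₀ (by simpa using hne)]
    · rw [herm_smul_right, star_inv₀, star_star, inv_mul_cancel₀ hne]
  have hww : herm w w = 0 := by
    rw [herm_smul_left, herm_smul_right] at hww'
    simpa [hc] using hww'
  have hwv : herm w v = 1 := by rw [← star_herm, hvw, star_one]
  -- The Hermitian cross product of `v` and `w`: pairing it with either one gives a determinant with
  -- a repeated row.
  set n : Fin 3 → ℂ := ![star (v 0 * w 1 - v 1 * w 0), star (v 2 * w 0 - v 0 * w 2),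
    star (v 1 * w 2 - v 2 * w 1)] with hn
  have hvn : herm v n = 0 := by simp [herm, hn]; ring
  have hwn : herm w n = 0 := by simp [herm, hn]; ring
  have hnv : herm n v = 0 := by rw [← star_herm, hvn, star_zero]
  have hnw : herm n w = 0 := by rw [← star_herm, hwn, star_zero]
  have hnn : herm n n = 1 := by
    -- Lagrange's identity for this form; it gives norm `1` because `v`, `w` are null and pair to
    -- `1`.
    have : herm n n = herm v w * herm w v - herm v v * herm w w := by simp [herm, hn]; ring
    rw [this, hvw, hwv, hvv]; ring
  obtain ⟨g, hg, h⟩ := exists_PU21_of_isometry (Fintype.linearCombination ℂ ![v, n, w]) (by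
    intro x y
    simp only [Fintype.linearCombination_apply, Fin.sum_univ_three, Matrix.cons_val,
      herm_add_left, herm_add_right, herm_smul_left, herm_smul_right, hvv, hvn, hvw, hnv, hnn, hnw,
      hwv, hwn, hww]
    simp only [herm]; ring)
  have e1 : Fintype.linearCombination ℂ ![v, n, w] ![1, 0, 0] = v := by
    simp [Fintype.linearCombination_apply, Fin.sum_univ_three]
  have e2 : Fintype.linearCombination ℂ ![v, n, w] (heisVec 0 0) = w := by
    simp [Fintype.linearCombination_apply, Fin.sum_univ_three, heisVec]
  have hw : w ≠ 0 := by rintro rfl; simp at hw'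
  refine ⟨g⁻¹, PU21.inv_mem hg, ?_, ?_⟩ <;> rw [Equiv.Perm.inv_eq_iff_eq]
  · rw [infty, h _ _ (by rwa [e1])]
    simp only [e1]
  · rw [heis_eq_mk, h _ (heisVec_ne_zero 0 0) (by rwa [e2])]
    exact (Projectivization.mk_eq_mk_iff' _ _ _ _ _).2 ⟨c, by rw [e2]⟩

/-! ### Normal forms -/

theorem configSetoid_mk_eq {p q : C4} :
    Quotient.mk configSetoid p = Quotient.mk configSetoid q ↔ ∃ g : PU21, g • q.1 = p.1 :=
  Quotient.eq

/-- The orbit of `(1, tan a)` under the dilations is the paraboloid `t = |z|² tan a` with its vertex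
removed, so the orbit condition excludes precisely this surface. -/
theorem normalQuad_mem_C4''_iff {a : ℝ} {z : ℂ} {t : ℝ} :
    normalQuad a z t ∈ C4'' ↔ z ≠ 0 ∧ t ≠ ‖z‖ ^ 2 * Real.tan a := by
  have hstab : (∃ g ∈ PU21, g infty = infty ∧ g (heis 0 0) = heis 0 0 ∧
      g (heis 1 (Real.tan a)) = heis z t) → t = ‖z‖ ^ 2 * Real.tan a := by
    rintro ⟨g, hg, h1, h2, h3⟩
    obtain ⟨c, hc⟩ := eq_dilation_of_stabiliser hg h1 h2
    rw [hc] at h3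
    obtain ⟨rfl, rfl⟩ := heis_injective h3
    rw [mul_one]
  constructor
  · rintro ⟨-, -, h1, h2⟩
    have hz : z ≠ 0 := fun h => h1 ((coll_iff z t).2 h)
    refine ⟨hz, fun h => ?_⟩
    obtain ⟨g, hg, hi, hd⟩ := exists_dilation hz
    refine h2 ⟨g, hg, hi, ?_, ?_⟩
    · change g (heis 0 0) = heis 0 0
      rw [hd]; simp
    · change g (heis 1 (Real.tan a)) = heis z t
      rw [hd, h, mul_one]
  · rintro ⟨hz, ht⟩
    refine ⟨⟨?_, ?_⟩, ?_, fun h => hz ((coll_iff z t).1 h), fun h => ht (hstab h)⟩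
    · have h01 := heis_ne_infty 1 (Real.tan a)
      have h02 : heis 1 (Real.tan a) ≠ heis 0 0 := fun h => one_ne_zero (heis_injective h).1
      have h03 : heis 1 (Real.tan a) ≠ heis z t := fun h => by
        obtain ⟨rfl, rfl⟩ := heis_injective h
        simp at ht
      have h12 := (heis_ne_infty 0 0).symm
      have h13 := (heis_ne_infty z t).symm
      have h23 : heis 0 0 ≠ heis z t := fun h => hz (heis_injective h).1.symm
      intro i j h
      fin_cases i <;> fin_cases j <;> first | rfl | skip
      · exact (h01 h).elim
      · exact (h02 h).elim
      · exact (h03 h).elim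
      · exact (h01 h.symm).elim
      · exact (h12 h).elim
      · exact (h13 h).elim
      · exact (h02 h.symm).elim
      · exact (h12 h.symm).elim
      · exact (h23 h).elim
      · exact (h03 h.symm).elim
      · exact (h13 h.symm).elim
      · exact (h23 h.symm).elim
    · intro i
      fin_cases i
      · exact heis_mem_boundary _ _
      · exact infty_mem_boundary
      · exact heis_mem_boundary _ _
      · exact heis_mem_boundary _ _
    · rintro ⟨S, hS, h1, h2, h3⟩
      exact one_ne_zero ((coll_iff 1 (Real.tan a)).1 ⟨S, hS, h2, h3, h1⟩)

theorem exists_isNormalForm (x : F4'') : ∃ q, IsNormalForm x q := by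
  obtain ⟨_, p, hp, rfl⟩ := x
  obtain ⟨g, hg, h1, h2⟩ := exists_PU21_normalise (p.2.2 1) (p.2.2 2)
    (fun h => absurd (p.2.1 h) (by decide))
  have heis_of_ne : ∀ i, i ≠ 1 → ∃ z t, g (p.1 i) = heis z t := fun i hi =>
    (eq_infty_or_heis (PU21_mem_boundary hg (p.2.2 i))).resolve_left fun h =>
      hi (p.2.1 (g.injective (h.trans h1.symm)))
  obtain ⟨z, t, h0⟩ := heis_of_ne 0 (by decide)
  obtain ⟨z', t', h3⟩ := heis_of_ne 3 (by decide)
  have hz : z ≠ 0 := by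
    rintro rfl
    obtain ⟨S, hS, hi, ho, hz⟩ := (coll_iff 0 t).2 rfl
    have hgp := (C4''_smul hp ⟨g, hg⟩).2.1
    refine hgp ⟨S, hS, ?_, ?_, ?_⟩
    · change g (p.1 0) ∈ S
      rwa [h0]
    · change g (p.1 1) ∈ S
      rwa [h1]
    · change g (p.1 2) ∈ S
      rwa [h2]
  -- The remaining freedom is used to bring the first point to `z`-coordinate `1`.
  obtain ⟨k, hk, hki, hkd⟩ := exists_dilation (inv_ne_zero hz)
  let G : PU21 := ⟨k * g, PU21.mul_mem hk hg⟩
  have hG : G • p.1 = normalQuad (Real.arctan (‖z⁻¹‖ ^ 2 * t)) (z⁻¹ * z') (‖z⁻¹‖ ^ 2 * t') := by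
    funext i
    fin_cases i
    · change k (g (p.1 0)) = heis 1 _
      rw [h0, hkd, inv_mul_cancel₀ hz, Real.tan_arctan]
    · change k (g (p.1 1)) = infty
      rw [h1, hki]
    · change k (g (p.1 2)) = heis 0 0
      rw [h2, hkd]; simp
    · change k (g (p.1 3)) = heis _ _
      rw [h3, hkd]
  refine ⟨(Real.arctan (‖z⁻¹‖ ^ 2 * t), z⁻¹ * z', ‖z⁻¹‖ ^ 2 * t'), ?_, ?_, ?_⟩
  · exact Real.arctan_mem_Ioo _
  · rw [← hG]; exact C4_smul p.2 G
  · exact configSetoid_mk_eq.2 ⟨G, hG⟩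

/-- An element relating two normal forms fixes `∞` and `(0,0)`, so it is a dilation by some `c`;
comparing the first points gives `c = 1`. Injectivity of `tan` on the interval then recovers `a`. -/
theorem IsNormalForm.unique {x : F4''} {q q' : ℝ × ℂ × ℝ} (h : IsNormalForm x q)
    (h' : IsNormalForm x q') : q = q' := by
  obtain ⟨a, z, t⟩ := q
  obtain ⟨a', z', t'⟩ := q'
  obtain ⟨ha, _, hx⟩ := h
  obtain ⟨ha', _, hx'⟩ := h'
  obtain ⟨⟨g, hg⟩, e⟩ := configSetoid_mk_eq.1 (hx'.trans hx.symm)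
  have e0 : g (heis 1 (Real.tan a)) = heis 1 (Real.tan a') := congrFun e 0
  have e1 : g infty = infty := congrFun e 1
  have e2 : g (heis 0 0) = heis 0 0 := congrFun e 2
  have e3 : g (heis z t) = heis z' t' := congrFun e 3
  obtain ⟨c, hc⟩ := eq_dilation_of_stabiliser hg e1 e2
  rw [hc] at e0 e3
  obtain ⟨h1, h2⟩ := heis_injective e0
  rw [mul_one] at h1
  subst h1
  obtain ⟨h3, h4⟩ := heis_injective e3
  simp at h2 h3 h4
  have h5 : a = a' := Real.injOn_tan ha ha' h2
  rw [h3, h4, h5]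

theorem existsUnique_isNormalForm (x : F4'') : ∃! q, IsNormalForm x q := by
  obtain ⟨q, hq⟩ := exists_isNormalForm x
  exact ⟨q, hq, fun q' hq' => hq'.unique hq⟩

theorem isNormalForm_normalForm (x : F4'') : IsNormalForm x (normalForm x) :=
  Classical.epsilon_spec (exists_isNormalForm x)

theorem IsNormalForm.mem {x : F4''} {q : ℝ × ℂ × ℝ} (h : IsNormalForm x q) :
    q.2.1 ≠ 0 ∧ q.2.2 ≠ ‖q.2.1‖ ^ 2 * Real.tan q.1 := by
  obtain ⟨-, hq, e⟩ := h
  obtain ⟨p, hp, e'⟩ := x.2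
  obtain ⟨g, hg⟩ := configSetoid_mk_eq.1 (e.trans e'.symm)
  rw [← normalQuad_mem_C4''_iff]
  have := C4''_smul hp g
  rwa [hg] at this

theorem bijOn_B0 : Set.BijOn B0 Set.univ cone' := by
  refine ⟨?_, ?_, ?_⟩
  · intro x _
    obtain ⟨hz, ht⟩ := (isNormalForm_normalForm x).mem
    refine ⟨hz, Real.exp_pos _, ?_⟩
    have : ‖(normalForm x).2.1‖ ^ 2 ≠ 0 := by simpa using hz
    simp only [B0, Real.log_exp]
    rw [ne_eq, eq_div_iff this, mul_comm]
    exact ht.symm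
  · intro x _ y _ h
    simp only [B0, Prod.mk.injEq, Real.exp_eq_exp] at h
    obtain ⟨h1, h2, h3⟩ := h
    have hx := isNormalForm_normalForm x
    have hy := isNormalForm_normalForm y
    have e : normalForm x = normalForm y :=
      Prod.ext (Real.injOn_tan hx.1 hy.1 h3) (Prod.ext h1 h2)
    obtain ⟨-, _, ex⟩ := hx
    obtain ⟨-, _, ey⟩ := hy
    apply Subtype.ext
    rw [← ex, ← ey]
    simp only [e]
    rfl
  · rintro ⟨z, t, r⟩ ⟨hz, hr, h⟩
    have hz2 : ‖z‖ ^ 2 ≠ 0 := by simpa using hz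
    have hmem : normalQuad (Real.arctan (Real.log r)) z t ∈ C4'' := by
      rw [normalQuad_mem_C4''_iff, Real.tan_arctan]
      refine ⟨hz, fun ht => h ?_⟩
      change Real.log r = t / ‖z‖ ^ 2
      rw [ht]; field_simp
    let x : F4'' := ⟨_, ⟨_, hmem.1⟩, hmem, rfl⟩
    have hx : IsNormalForm x (Real.arctan (Real.log r), z, t) :=
      ⟨Real.arctan_mem_Ioo _, hmem.1, rfl⟩
    refine ⟨x, trivial, ?_⟩
    have e := (isNormalForm_normalForm x).unique hx
    simp only [B0, e, Real.tan_arctan, Real.exp_log hr]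

namespace ComplexStructure

/-! ### The complex structure defined by one global chart -/

variable {X : Type} [Nonempty X]

/-- The complex structure on `X` for which the injection `φ`, with open range in `ℂ × ℂ`, is a
global holomorphic chart. -/
def ofChart (φ : X → ℂ × ℂ) (hφ : Function.Injective φ) (ho : IsOpen (Set.range φ)) :
    ComplexStructure X :=
  letI : TopologicalSpace X := TopologicalSpace.induced φ inferInstance
  have h : Topology.IsOpenEmbedding φ := ⟨⟨⟨rfl⟩, hφ⟩, ho⟩
  letI : ChartedSpace (ℂ × ℂ) X := h.singletonChartedSpace
  { t2 := h.isEmbedding.t2Space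
    secondCountable := h.isEmbedding.secondCountableTopology
    holo := h.isManifold_singleton }

variable {φ : X → ℂ × ℂ} (hφ : Function.Injective φ) (ho : IsOpen (Set.range φ))

theorem ofChart_isOpenEmbedding :
    Topology.IsOpenEmbedding ((ofChart φ hφ ho).onSpace φ) := ⟨⟨⟨rfl⟩, hφ⟩, ho⟩

theorem ofChart_chartAt_apply (x y : (ofChart φ hφ ho).Space) :
    chartAt (ℂ × ℂ) x y = φ y := rfl

theorem ofChart_chartAt_symm (x y : (ofChart φ hφ ho).Space) :
    (chartAt (ℂ × ℂ) x).symm (φ y) = y := by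
  have := (chartAt (ℂ × ℂ) x).left_inv (x := y) (Set.mem_univ y)
  rwa [ofChart_chartAt_apply] at this

section Vec

variable {E : Type} [NormedAddCommGroup E] [NormedSpace ℝ E] {f : X → E} {F : ℂ × ℂ → E}

/-- Reading a map in the single chart gives `F` on the open range of `φ` only; outside it the
inverse chart has no meaning, so equality near the point is what can be used. Calculus on the
manifold is thereby reduced to calculus of `F` on `ℂ × ℂ`. -/
theorem eventuallyEq_of_comp {Y : Type} (x : (ofChart φ hφ ho).Space) {f : X → Y}
    {F : ℂ × ℂ → Y} (hF : ∀ y, F (φ y) = f y) :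
    (fun q => f ((chartAt (ℂ × ℂ) x).symm q)) =ᶠ[nhds (φ x)] F := by
  filter_upwards [ho.mem_nhds ⟨x, rfl⟩]
  rintro _ ⟨y, rfl⟩
  rw [ofChart_chartAt_symm hφ ho x y, hF]

theorem hasMFDerivAt_onSpace (hF : ∀ y, F (φ y) = f y) (x : (ofChart φ hφ ho).Space)
    {F' : (ℂ × ℂ) →L[ℝ] E} (h : HasFDerivAt F F' (φ x)) :
    HasMFDerivAt 𝓘(ℝ, ℂ × ℂ) 𝓘(ℝ, E) ((ofChart φ hφ ho).onSpace f) x F' := by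
  constructor
  · have : (ofChart φ hφ ho).onSpace f = F ∘ (ofChart φ hφ ho).onSpace φ :=
      funext fun y => (hF y).symm
    rw [this]
    exact h.continuousAt.comp (ofChart_isOpenEmbedding hφ ho).continuous.continuousAt
  · exact (h.congr_of_eventuallyEq (eventuallyEq_of_comp hφ ho x hF)).hasFDerivWithinAt

theorem contMDiff_onSpace (hF : ∀ y, F (φ y) = f y) (h : ∀ y, ContDiffAt ℝ ∞ F (φ y)) :
    ContMDiff 𝓘(ℝ, ℂ × ℂ) 𝓘(ℝ, E) ∞ ((ofChart φ hφ ho).onSpace f) := by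
  intro x
  rw [contMDiffAt_iff]
  constructor
  · have : (ofChart φ hφ ho).onSpace f = F ∘ (ofChart φ hφ ho).onSpace φ :=
      funext fun y => (hF y).symm
    rw [this]
    exact (h x).continuousAt.comp (ofChart_isOpenEmbedding hφ ho).continuous.continuousAt
  · exact ((h x).congr_of_eventuallyEq (eventuallyEq_of_comp hφ ho x hF)).contDiffWithinAt

theorem contMDiffOn_toSpace {g : E → (ofChart φ hφ ho).Space} {U : Set E} {Φ : E → ℂ × ℂ}
    (hU : IsOpen U) (hg : ∀ p ∈ U, φ (g p) = Φ p) (h : ∀ p ∈ U, ContDiffAt ℝ ∞ Φ p) :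
    ContMDiffOn 𝓘(ℝ, E) 𝓘(ℝ, ℂ × ℂ) ∞ g U := by
  intro p hp
  apply ContMDiffAt.contMDiffWithinAt
  have hev : (fun p => φ (g p)) =ᶠ[nhds p] Φ := by
    filter_upwards [hU.mem_nhds hp] with y hy using hg y hy
  rw [contMDiffAt_iff]
  constructor
  · rw [(ofChart_isOpenEmbedding hφ ho).isEmbedding.isInducing.continuousAt_iff]
    exact (h p hp).continuousAt.congr hev.symm
  · exact ((h p hp).congr_of_eventuallyEq hev).contDiffWithinAt

end Vec

variable {ψ : X → ℂ × ℂ} (hψ : Function.Injective ψ) (hoψ : IsOpen (Set.range ψ))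
  {F : ℂ × ℂ → ℂ × ℂ}

theorem continuousAt_idMap (hF : ∀ y, F (φ y) = ψ y) (x : (ofChart φ hφ ho).Space)
    (h : ContinuousAt F (φ x)) :
    ContinuousAt (idMap (ofChart φ hφ ho) (ofChart ψ hψ hoψ)) x := by
  rw [(ofChart_isOpenEmbedding hψ hoψ).isEmbedding.isInducing.continuousAt_iff]
  have : (ofChart ψ hψ hoψ).onSpace ψ ∘ idMap (ofChart φ hφ ho) (ofChart ψ hψ hoψ) =
      F ∘ (ofChart φ hφ ho).onSpace φ := funext fun y => (hF y).symm
  rw [this]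
  exact h.comp (ofChart_isOpenEmbedding hφ ho).continuous.continuousAt

theorem hasMFDerivAt_idMap (hF : ∀ y, F (φ y) = ψ y) (x : (ofChart φ hφ ho).Space)
    {F' : (ℂ × ℂ) →L[ℝ] (ℂ × ℂ)} (h : HasFDerivAt F F' (φ x)) :
    HasMFDerivAt 𝓘(ℝ, ℂ × ℂ) 𝓘(ℝ, ℂ × ℂ) (idMap (ofChart φ hφ ho) (ofChart ψ hψ hoψ)) x F' :=
  ⟨continuousAt_idMap hφ ho hψ hoψ hF x h.continuousAt,
    (h.congr_of_eventuallyEq (eventuallyEq_of_comp hφ ho x hF)).hasFDerivWithinAt⟩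

theorem contMDiff_idMap (hF : ∀ y, F (φ y) = ψ y) (h : ∀ y, ContDiffAt ℝ ∞ F (φ y)) :
    ContMDiff 𝓘(ℝ, ℂ × ℂ) 𝓘(ℝ, ℂ × ℂ) ∞ (idMap (ofChart φ hφ ho) (ofChart ψ hψ hoψ)) := by
  intro x
  rw [contMDiffAt_iff]
  exact ⟨continuousAt_idMap hφ ho hψ hoψ hF x (h x).continuousAt,
    ((h x).congr_of_eventuallyEq (eventuallyEq_of_comp hφ ho x hF)).contDiffWithinAt⟩

theorem differentiableAt_of_mdifferentiableAt_idMap (hF : ∀ y, F (φ y) = ψ y)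
    (x : (ofChart φ hφ ho).Space)
    (h : MDifferentiableAt 𝓘(ℂ, ℂ × ℂ) 𝓘(ℂ, ℂ × ℂ)
      (idMap (ofChart φ hφ ho) (ofChart ψ hψ hoψ)) x) : DifferentiableAt ℂ F (φ x) := by
  have h2 := (mdifferentiableAt_iff _ _).1 h |>.2
  have h3 : DifferentiableWithinAt ℂ (fun q => ψ ((chartAt (ℂ × ℂ) x).symm q))
    (Set.range (id : ℂ × ℂ → ℂ × ℂ)) (φ x) := h2
  rw [Set.range_id, differentiableWithinAt_univ] at h3
  exact h3.congr_of_eventuallyEq (eventuallyEq_of_comp hφ ho x hF).symm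

end ComplexStructure

/-! ### The holomorphic chart of the cone -/

/-- The global holomorphic chart `(z, t, r) ↦ (r z, |z|² - i t)` of `(C'(H⋆), 𝕁)`. -/
def coneChart (p : ℂ × ℝ × ℝ) : ℂ × ℂ :=
  (p.2.2 • p.1, (‖p.1‖ ^ 2) • (1 : ℂ) - p.2.1 • Complex.I)

/-- The inverse of `coneChart`. -/
def coneChartInv (q : ℂ × ℂ) : ℂ × ℝ × ℝ :=
  ((Real.sqrt q.2.re / ‖q.1‖) • q.1, -q.2.im, ‖q.1‖ / Real.sqrt q.2.re)

/-- The real part of the second coordinate is `|z|²`, and the modulus of the first is `r|z|`;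
together they determine `r`. -/
theorem coneChartInv_coneChart {p : ℂ × ℝ × ℝ} (hp : p ∈ cone') :
    coneChartInv (coneChart p) = p := by
  obtain ⟨z, t, r⟩ := p
  obtain ⟨hz, hr, -⟩ := hp
  have hz : z ≠ 0 := hz
  have hr : 0 < r := hr
  have hre : ((‖z‖ ^ 2) • (1 : ℂ) - t • Complex.I).re = ‖z‖ ^ 2 := by
    simp [-Complex.ofReal_pow]
  have him : ((‖z‖ ^ 2) • (1 : ℂ) - t • Complex.I).im = -t := by
    simp [-Complex.ofReal_pow]
  have hn : ‖z‖ ≠ 0 := by simpa using hz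
  simp only [coneChart, coneChartInv, hre, him, neg_neg, Real.sqrt_sq (norm_nonneg z), norm_smul,
    Real.norm_of_nonneg hr.le, smul_smul]
  have h1 : ‖z‖ / (r * ‖z‖) * r = 1 := by field_simp
  have h2 : r * ‖z‖ / ‖z‖ = r := by field_simp
  rw [h1, h2, one_smul]

theorem coneChart_coneChartInv {q : ℂ × ℂ} (h1 : q.1 ≠ 0) (h2 : 0 < q.2.re) :
    coneChart (coneChartInv q) = q := by
  obtain ⟨u, w⟩ := q
  have hn : ‖u‖ ≠ 0 := by simpa using h1
  have hs : Real.sqrt w.re ≠ 0 := (Real.sqrt_pos.2 h2).ne'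
  have e1 : ‖u‖ / Real.sqrt w.re * (Real.sqrt w.re / ‖u‖) = 1 := by field_simp
  have e2 : ‖(Real.sqrt w.re / ‖u‖) • u‖ = Real.sqrt w.re := by
    rw [norm_smul, Real.norm_of_nonneg (by positivity)]; field_simp
  simp only [coneChart, coneChartInv, smul_smul, e1, e2, one_smul, Real.sq_sqrt h2.le]
  refine Prod.ext rfl (Complex.ext ?_ ?_) <;> simp

theorem contDiff_coneChart : ContDiff ℝ ∞ coneChart := by
  unfold coneChart
  have h : ContDiff ℝ ∞ fun p : ℂ × ℝ × ℝ => ‖p.1‖ ^ 2 := contDiff_fst.norm_sq ℝ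
  fun_prop

theorem contDiffAt_coneChartInv {q : ℂ × ℂ} (h1 : q.1 ≠ 0) (h2 : 0 < q.2.re) :
    ContDiffAt ℝ ∞ coneChartInv q := by
  unfold coneChartInv
  have hn : ContDiffAt ℝ ∞ (fun q : ℂ × ℂ => ‖q.1‖) q := contDiffAt_fst.norm ℝ h1
  have hre : ContDiffAt ℝ ∞ (fun q : ℂ × ℂ => q.2.re) q :=
    Complex.reCLM.contDiff.contDiffAt.comp q contDiffAt_snd
  have him : ContDiffAt ℝ ∞ (fun q : ℂ × ℂ => q.2.im) q :=
    Complex.imCLM.contDiff.contDiffAt.comp q contDiffAt_snd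
  have hs : ContDiffAt ℝ ∞ (fun q : ℂ × ℂ => Real.sqrt q.2.re) q := hre.sqrt h2.ne'
  exact ((hs.div hn (by simpa using h1)).smul contDiffAt_fst).prodMk
    (him.neg.prodMk (hn.div hs (Real.sqrt_pos.2 h2).ne'))

theorem isOpen_cone' : IsOpen cone' := by
  have ho : IsOpen {p : ℂ × ℝ × ℝ | p.1 ≠ 0 ∧ 0 < p.2.2} :=
    (isOpen_ne.preimage continuous_fst).inter
      (isOpen_lt continuous_const (continuous_snd.comp continuous_snd))
  have hc : ContinuousOn (fun p : ℂ × ℝ × ℝ => Real.log p.2.2 - p.2.1 / ‖p.1‖ ^ 2)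
      {p : ℂ × ℝ × ℝ | p.1 ≠ 0 ∧ 0 < p.2.2} := by
    refine ContinuousOn.sub (ContinuousOn.log (by fun_prop) fun p hp => hp.2.ne')
      (ContinuousOn.div (by fun_prop) (by fun_prop) fun p hp => ?_)
    simpa using hp.1
  have := hc.isOpen_inter_preimage ho (isOpen_ne (x := (0 : ℝ)))
  convert this using 1
  ext p
  simp only [cone', Set.mem_ofPred_eq, Set.mem_inter_iff, Set.mem_preimage, ne_eq, sub_eq_zero,
    and_assoc]

theorem coneChart_mem {p : ℂ × ℝ × ℝ} (hp : p ∈ cone') :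
    (coneChart p).1 ≠ 0 ∧ 0 < (coneChart p).2.re := by
  obtain ⟨hz, hr, -⟩ := hp
  have hn : ‖p.1‖ ≠ 0 := by simpa using hz
  refine ⟨smul_ne_zero hr.ne' hz, ?_⟩
  have : (coneChart p).2.re = ‖p.1‖ ^ 2 := by simp [coneChart, -Complex.ofReal_pow]
  rw [this]; positivity

/-- The image is the preimage of `cone'` under the continuous inverse, taken inside the open set
where that inverse is valid. -/
theorem isOpen_image_coneChart : IsOpen (coneChart '' cone') := by
  have ho : IsOpen {q : ℂ × ℂ | q.1 ≠ 0 ∧ 0 < q.2.re} :=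
    (isOpen_ne.preimage continuous_fst).inter
      (isOpen_lt continuous_const (Complex.continuous_re.comp continuous_snd))
  have hc : ContinuousOn coneChartInv {q : ℂ × ℂ | q.1 ≠ 0 ∧ 0 < q.2.re} := fun q hq =>
    (contDiffAt_coneChartInv hq.1 hq.2).continuousAt.continuousWithinAt
  have := hc.isOpen_inter_preimage ho isOpen_cone'
  convert this using 1
  ext q
  constructor
  · rintro ⟨p, hp, rfl⟩
    refine ⟨coneChart_mem hp, ?_⟩
    rwa [Set.mem_preimage, coneChartInv_coneChart hp]
  · rintro ⟨hq, h⟩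
    exact ⟨_, h, coneChart_coneChartInv hq.1 hq.2⟩

/-- The real differential of `|z|² - i t`. -/
theorem hasFDerivAt_normSq_sub (p : ℂ × ℝ × ℝ) :
    ∃ W : (ℂ × ℝ × ℝ) →L[ℝ] ℂ,
      HasFDerivAt (fun p : ℂ × ℝ × ℝ => (‖p.1‖ ^ 2) • (1 : ℂ) - p.2.1 • Complex.I) W p ∧
      ∀ v, W v = (2 * (star p.1 * v.1).re : ℝ) - Complex.I * v.2.1 := by
  have h1 : HasFDerivAt (fun p : ℂ × ℝ × ℝ => ‖p.1‖ ^ 2) _ p :=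
    (hasFDerivAt_fst (𝕜 := ℝ) (p := p)).norm_sq
  have h2 : HasFDerivAt (fun p : ℂ × ℝ × ℝ => p.2.1) _ p :=
    (hasFDerivAt_snd (𝕜 := ℝ) (p := p)).fst
  refine ⟨_, (h1.smul_const (1 : ℂ)).sub (h2.smul_const Complex.I), fun v => ?_⟩
  simp [Complex.inner]
  ring

theorem fderiv_coneChart_apply (p v : ℂ × ℝ × ℝ) :
    fderiv ℝ coneChart p v =
      (p.2.2 • v.1 + v.2.2 • p.1, (2 * (star p.1 * v.1).re : ℝ) - Complex.I * v.2.1) := by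
  obtain ⟨W, hW, hWv⟩ := hasFDerivAt_normSq_sub p
  have h1 : HasFDerivAt (fun p : ℂ × ℝ × ℝ => p.2.2 • p.1) _ p :=
    (hasFDerivAt_snd (𝕜 := ℝ) (p := p)).snd.smul (hasFDerivAt_fst (𝕜 := ℝ) (p := p))
  have h : HasFDerivAt coneChart _ p := h1.prodMk hW
  rw [h.fderiv, ContinuousLinearMap.prod_apply, hWv]
  simp

/-- On `X, Y, T, S` the differential of `rz` takes the values `rz, irz, irz, rz`, and that of `|z|²
- it` the values `2|z|², 2i|z|², 0, 0`. Both match multiplication by `i` with `𝕁 X = Y` and `𝕁 T =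
-S`. -/
theorem fderiv_coneChart_coneJ {p : ℂ × ℝ × ℝ} (hz : p.1 ≠ 0) (hr : p.2.2 ≠ 0)
    (v : ℂ × ℝ × ℝ) :
    fderiv ℝ coneChart p (coneJ p v) = Complex.I • fderiv ℝ coneChart p v := by
  obtain ⟨z, t, r⟩ := p
  obtain ⟨v, s, ρ⟩ := v
  -- In the logarithmic variable `ζ = dz / z` the forms simplify: `φ⋆` becomes `Re ζ` and `d arg z`
  -- becomes `Im ζ`.
  obtain ⟨ζ, rfl⟩ : ∃ ζ, v = z * ζ := ⟨v / z, by field_simp [show z ≠ 0 from hz]⟩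
  have hz : ‖z‖ ^ 2 ≠ 0 := by simpa using hz
  have hr : r ≠ 0 := hr
  have hzz : ∀ c, star z * (z * c) = ((‖z‖ ^ 2 : ℝ) : ℂ) * c := fun c => by
    rw [← mul_assoc, mul_comm (star z), mul_star_eq_norm_sq]
  have hφ : formPhi (z, t, r) (z * ζ, s, ρ) = ζ.re := by
    simp only [formPhi, hzz, Complex.re_ofReal_mul]; field_simp
  have hω : formOmega (z, t, r) (z * ζ, s, ρ) = s / (2 * ‖z‖ ^ 2) + ζ.im := by
    simp only [formOmega, hzz, Complex.im_ofReal_mul]; field_simp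
  set n := ‖z‖ ^ 2 with hn
  have hJ : coneJ (z, t, r) (z * ζ, s, ρ) =
      (z * (Complex.I * ζ.re + (s / (2 * n) : ℝ) + Complex.I * (ρ / r : ℝ)), -2 * n * ζ.re,
        -(s / (2 * n) + ζ.im) * r) := by
    simp only [coneJ, hφ, hω, formPsi, fieldX, fieldY, fieldT, fieldS, ← hn]
    refine Prod.ext ?_ (Prod.ext ?_ ?_)
    · simp; ring
    · simp; ring
    · simp; ring
  have hζ : ζ = ζ.re + ζ.im * Complex.I := (Complex.re_add_im ζ).symm
  rw [hJ, fderiv_coneChart_apply, fderiv_coneChart_apply]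
  simp only [hzz]
  refine Prod.ext ?_ ?_
  · have hr' : (r : ℂ) ≠ 0 := by exact_mod_cast hr
    have hρ : (r : ℂ) * (ρ / r) = ρ := by field_simp
    simp only [Prod.smul_fst, Complex.real_smul, smul_eq_mul]
    push_cast
    linear_combination (Complex.I * z) * hρ - (Complex.I * r * z) * hζ
      - (r * z * ζ.im) * Complex.I_mul_I
  · have e : 2 * n * (s / (2 * n)) = s := by field_simp
    simp only [Prod.smul_snd, smul_eq_mul]
    apply Complex.ext
    · generalize s / (2 * n) = σ at e ⊢
      generalize ρ / r = τ
      rw [← e]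
      simp; ring
    · simp; ring

/-! ### The comparison map -/

/-- The map `(z, t, r) ↦ (z, (|z|² - i t) / (1 - i log r))`. -/
def compare (p : ℂ × ℝ × ℝ) : ℂ × ℂ :=
  (p.1, ((‖p.1‖ ^ 2) • (1 : ℂ) - p.2.1 • Complex.I) * (1 - Real.log p.2.2 • Complex.I)⁻¹)

/-- The inverse of `compare`. -/
def compareInv (q : ℂ × ℂ) : ℂ × ℝ × ℝ :=
  (q.1, (‖q.1‖ ^ 2 - q.2.re) / q.2.im * q.2.re - q.2.im,
    Real.exp ((‖q.1‖ ^ 2 - q.2.re) / q.2.im))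

theorem one_sub_smul_I_ne_zero (s : ℝ) : (1 : ℂ) - s • Complex.I ≠ 0 := by
  intro h
  have := congrArg Complex.re h
  simp at this

theorem compare_snd (p : ℂ × ℝ × ℝ) :
    (compare p).2.re = (‖p.1‖ ^ 2 + p.2.1 * Real.log p.2.2) / (1 + Real.log p.2.2 ^ 2) ∧
    (compare p).2.im = (‖p.1‖ ^ 2 * Real.log p.2.2 - p.2.1) / (1 + Real.log p.2.2 ^ 2) := by
  have h : 1 + Real.log p.2.2 ^ 2 ≠ 0 := by positivity
  have hN : Complex.normSq (1 - Real.log p.2.2 • Complex.I) = 1 + Real.log p.2.2 ^ 2 := by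
    simp [Complex.normSq_apply]; ring
  constructor
  · simp only [compare, Complex.mul_re, Complex.inv_re, Complex.inv_im, hN]
    simp [-Complex.ofReal_pow]; field_simp
  · simp only [compare, Complex.mul_im, Complex.inv_re, Complex.inv_im, hN]
    simp [-Complex.ofReal_pow]; field_simp; ring

/-- The imaginary part vanishes exactly when `|z|² log r = t`, the locus removed from the cone. -/
theorem compare_mem {p : ℂ × ℝ × ℝ} (hp : p ∈ cone') :
    (compare p).1 ≠ 0 ∧ (compare p).2.im ≠ 0 := by
  obtain ⟨hz, -, h⟩ := hp
  have hn : ‖p.1‖ ^ 2 ≠ 0 := by simpa using hz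
  refine ⟨hz, ?_⟩
  rw [(compare_snd p).2]
  refine div_ne_zero (fun h0 => h ?_) (by positivity)
  rw [eq_div_iff hn]
  linarith

/-- Put `s = log r`. The real and imaginary parts of `w (1 - is) = |z|² - it` give `s = (|z|² - Re
w) / Im w` and `t = s Re w - Im w`. -/
theorem compareInv_compare {p : ℂ × ℝ × ℝ} (hp : p ∈ cone') : compareInv (compare p) = p := by
  have him := (compare_mem hp).2
  have hr := hp.2.1
  obtain ⟨z, t, r⟩ := p
  have h : 1 + Real.log r ^ 2 ≠ 0 := by positivity
  rw [(compare_snd _).2] at him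
  have him : ‖z‖ ^ 2 * Real.log r - t ≠ 0 := fun h => him (by simp [h])
  have hτ : (‖z‖ ^ 2 - (compare (z, t, r)).2.re) / (compare (z, t, r)).2.im = Real.log r := by
    rw [(compare_snd _).1, (compare_snd _).2]
    field_simp
    ring
  unfold compareInv
  change (z, (‖z‖ ^ 2 - (compare (z, t, r)).2.re) / _ * _ - _,
    Real.exp ((‖z‖ ^ 2 - (compare (z, t, r)).2.re) / _)) = _
  rw [hτ, Real.exp_log hr, (compare_snd _).1, (compare_snd _).2]
  refine Prod.ext rfl (Prod.ext ?_ rfl)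
  simp only
  field_simp
  ring

theorem compare_compareInv {q : ℂ × ℂ} (h2 : q.2.im ≠ 0) : compare (compareInv q) = q := by
  obtain ⟨z, w⟩ := q
  have hw : w.im ≠ 0 := h2
  refine Prod.ext rfl ?_
  simp only [compare, compareInv, Real.log_exp]
  rw [← div_eq_mul_inv, div_eq_iff (one_sub_smul_I_ne_zero _)]
  apply Complex.ext
  · simp; field_simp; ring
  · simp; field_simp; ring

theorem compareInv_mem {q : ℂ × ℂ} (h1 : q.1 ≠ 0) (h2 : q.2.im ≠ 0) : compareInv q ∈ cone' := by
  have h : (compare (compareInv q)).2.im ≠ 0 := by rwa [compare_compareInv h2]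
  refine ⟨h1, Real.exp_pos _, fun h0 => h ?_⟩
  have hn : ‖(compareInv q).1‖ ^ 2 ≠ 0 := pow_ne_zero 2 (norm_ne_zero_iff.2 h1)
  rw [eq_div_iff hn] at h0
  rw [(compare_snd _).2, mul_comm, h0, sub_self, zero_div]

theorem bijOn_compare : Set.BijOn compare cone' {q : ℂ × ℂ | q.1 ≠ 0 ∧ q.2.im ≠ 0} :=
  Set.InvOn.bijOn (f' := compareInv)
    ⟨fun _ hp => compareInv_compare hp, fun _ hq => compare_compareInv hq.2⟩
    (fun _ hp => compare_mem hp) (fun _ hq => compareInv_mem hq.1 hq.2)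

theorem contDiffAt_compare {p : ℂ × ℝ × ℝ} (hr : 0 < p.2.2) : ContDiffAt ℝ ∞ compare p := by
  unfold compare
  have hn : ContDiffAt ℝ ∞ (fun p : ℂ × ℝ × ℝ => ‖p.1‖ ^ 2) p := contDiffAt_fst.norm_sq ℝ
  have hl : ContDiffAt ℝ ∞ (fun p : ℂ × ℝ × ℝ => Real.log p.2.2) p :=
    ContDiffAt.log (by fun_prop) hr.ne'
  have hi := (contDiffAt_const (c := (1 : ℂ)).sub
    (hl.smul (contDiffAt_const (c := Complex.I)))).inv (one_sub_smul_I_ne_zero _)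
  refine contDiffAt_fst.prodMk (ContDiffAt.mul ?_ hi)
  fun_prop

theorem contDiffAt_compareInv {q : ℂ × ℂ} (h : q.2.im ≠ 0) : ContDiffAt ℝ ∞ compareInv q := by
  unfold compareInv
  have hn : ContDiffAt ℝ ∞ (fun q : ℂ × ℂ => ‖q.1‖ ^ 2) q := contDiffAt_fst.norm_sq ℝ
  have hre : ContDiffAt ℝ ∞ (fun q : ℂ × ℂ => q.2.re) q :=
    Complex.reCLM.contDiff.contDiffAt.comp q contDiffAt_snd
  have him : ContDiffAt ℝ ∞ (fun q : ℂ × ℂ => q.2.im) q :=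
    Complex.imCLM.contDiff.contDiffAt.comp q contDiffAt_snd
  have hτ := (hn.sub hre).div him h
  exact contDiffAt_fst.prodMk (((hτ.mul hre).sub him).prodMk hτ.exp)

theorem fderiv_compare_fst {p : ℂ × ℝ × ℝ} (hr : 0 < p.2.2) (v : ℂ × ℝ × ℝ) :
    (fderiv ℝ compare p v).1 = v.1 := by
  have h : HasFDerivAt (fun p => (compare p).1) _ p :=
    ((contDiffAt_compare hr).differentiableAt (by simp)).hasFDerivAt.fst
  exact congrArg (fun A : (ℂ × ℝ × ℝ) →L[ℝ] ℂ => A v)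
    (h.unique (hasFDerivAt_fst (𝕜 := ℝ) (p := p)))

/-- The denominator depends on `r` alone, so along vectors without `r`-component it acts as a
constant. These vectors suffice, since `X` and `Y` are among them. -/
theorem fderiv_compare_snd {p : ℂ × ℝ × ℝ} (hr : 0 < p.2.2) {v : ℂ × ℝ × ℝ} (hv : v.2.2 = 0) :
    (fderiv ℝ compare p v).2 =
      ((2 * (star p.1 * v.1).re : ℝ) - Complex.I * v.2.1) *
        (1 - Real.log p.2.2 • Complex.I)⁻¹ := by
  have h : HasFDerivAt (fun p => (compare p).2) _ p :=
    ((contDiffAt_compare hr).differentiableAt (by simp)).hasFDerivAt.snd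
  obtain ⟨W, hW, hWv⟩ := hasFDerivAt_normSq_sub p
  have hg : DifferentiableAt ℝ (fun r : ℝ => ((1 : ℂ) - Real.log r • Complex.I)⁻¹) p.2.2 := by
    refine DifferentiableAt.inv ?_ (one_sub_smul_I_ne_zero _)
    exact (differentiableAt_const _).sub
      ((Real.differentiableAt_log hr.ne').smul (differentiableAt_const _))
  have hgp := hg.hasFDerivAt.comp p (hasFDerivAt_snd (𝕜 := ℝ) (p := p)).snd
  have h' := hW.mul hgp
  have e := congrArg (fun A : (ℂ × ℝ × ℝ) →L[ℝ] ℂ => A v) (h.unique h')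
  refine e.trans ?_
  simp [hWv, hv]
  ring

/-! ### The horizontal bundle -/

/-- The core of the CR statement: it suffices to see that the differential sends `Y` to `i` times
the image of `X`. -/
theorem coneJ_mem_coneH {p h : ℂ × ℝ × ℝ} (hz : p.1 ≠ 0) (hr : 0 < p.2.2)
    (hh : h ∈ coneH p) :
    coneJ p h ∈ coneH p ∧
      fderiv ℝ compare p (coneJ p h) = Complex.I • fderiv ℝ compare p h := by
  obtain ⟨a, b, rfl⟩ := Submodule.mem_span_pair.1 hh
  have hJ : coneJ p (a • fieldX p + b • fieldY p) = a • fieldY p - b • fieldX p := by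
    have hlin : coneJ p (a • fieldX p + b • fieldY p) =
        a • coneJ p (fieldX p) + b • coneJ p (fieldY p) := by
      simp only [coneJ, formPhi, formPsi, formOmega, fieldX, fieldY, fieldS, fieldT]
      refine Prod.ext ?_ (Prod.ext ?_ ?_) <;> simp <;> ring
    rw [hlin, coneJ_X hz, coneJ_Y hz]
    simp [sub_eq_add_neg]
  have hYX : fderiv ℝ compare p (fieldY p) = Complex.I • fderiv ℝ compare p (fieldX p) := by
    refine Prod.ext ?_ ?_
    · rw [fderiv_compare_fst hr, Prod.smul_fst, fderiv_compare_fst hr]; rfl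
    · rw [fderiv_compare_snd hr rfl, Prod.smul_snd, fderiv_compare_snd hr rfl]
      simp only [fieldX, fieldY, star_mul_I_re, star_mul_self_re]
      simp; ring
  rw [hJ]
  refine ⟨sub_mem (Submodule.smul_mem _ _ (Submodule.subset_span (by simp)))
    (Submodule.smul_mem _ _ (Submodule.subset_span (by simp))), ?_⟩
  simp only [map_sub, map_add, map_smul, hYX, smul_add]
  rw [smul_comm Complex.I b, smul_smul Complex.I, Complex.I_mul_I, smul_comm Complex.I a]
  simp [sub_eq_add_neg]

theorem finrank_coneH {p : ℂ × ℝ × ℝ} (hz : p.1 ≠ 0) : Module.finrank ℝ (coneH p) = 2 := by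
  have hn : ‖p.1‖ ≠ 0 := by simpa using hz
  have hli : LinearIndependent ℝ ![fieldX p, fieldY p] := by
    rw [LinearIndependent.pair_iff]
    intro a b h
    have h1 := congrArg (fun q : ℂ × ℝ × ℝ => q.1) h
    have h2 := congrArg (fun q : ℂ × ℝ × ℝ => q.2.1) h
    simp [fieldX, fieldY, hn] at h2
    subst h2
    simp [fieldX, hz] at h1
    exact ⟨h1, rfl⟩
  have := finrank_span_eq_card hli
  rwa [Matrix.range_cons_cons_empty, Fintype.card_fin] at this

/-! ### The two complex structures of `F₄''` -/

theorem B0_mem (x : F4'') : B0 x ∈ cone' := bijOn_B0.mapsTo (Set.mem_univ x)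

theorem compare_B0 (x : F4'') : compare (B0 x) = B1 x := by
  refine Prod.ext rfl ?_
  simp only [compare, B0, B1, Real.log_exp, Complex.real_smul, div_eq_mul_inv, mul_one,
    mul_comm Complex.I]

theorem coneChartInv_coneChart_B0 (x : F4'') : coneChartInv (coneChart (B0 x)) = B0 x :=
  coneChartInv_coneChart (B0_mem x)

theorem compareInv_B1 (x : F4'') : compareInv (B1 x) = B0 x := by
  rw [← compare_B0, compareInv_compare (B0_mem x)]

theorem bijOn_B1 : Set.BijOn B1 Set.univ {q : ℂ × ℂ | q.1 ≠ 0 ∧ q.2.im ≠ 0} :=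
  (bijOn_compare.comp bijOn_B0).congr fun x _ => compare_B0 x

theorem injective_B0 : Function.Injective B0 := Set.injOn_univ.1 bijOn_B0.injOn

theorem injective_B1 : Function.Injective B1 := Set.injOn_univ.1 bijOn_B1.injOn

theorem injective_coneChart_B0 : Function.Injective fun x => coneChart (B0 x) :=
  fun x y h => injective_B0 (by
    rw [← coneChartInv_coneChart_B0 x, ← coneChartInv_coneChart_B0 y]; exact congrArg _ h)

theorem range_B0 : Set.range B0 = cone' := by rw [← Set.image_univ, bijOn_B0.image_eq]

theorem range_B1 : Set.range B1 = {q : ℂ × ℂ | q.1 ≠ 0 ∧ q.2.im ≠ 0} := by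
  rw [← Set.image_univ, bijOn_B1.image_eq]

theorem isOpen_range_B1 : IsOpen (Set.range B1) := by
  rw [range_B1]
  exact (isOpen_ne.preimage continuous_fst).inter
    (isOpen_ne.preimage (Complex.continuous_im.comp continuous_snd))

theorem isOpen_range_coneChart_B0 : IsOpen (Set.range fun x => coneChart (B0 x)) := by
  have : (Set.range fun x => coneChart (B0 x)) = coneChart '' cone' := by
    rw [← range_B0, ← Set.range_comp]; rfl
  rw [this]
  exact isOpen_image_coneChart

instance : Nonempty F4'' := by
  obtain ⟨x, -⟩ := bijOn_B1.surjOn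
    (show ((1, Complex.I) : ℂ × ℂ) ∈ {q : ℂ × ℂ | q.1 ≠ 0 ∧ q.2.im ≠ 0} by simp)
  exact ⟨x⟩

/-- The complex structure of `F₄''` pulled back by `B₀`. -/
def structureM0 : ComplexStructure F4'' :=
  ComplexStructure.ofChart _ injective_coneChart_B0 isOpen_range_coneChart_B0

/-- The complex structure of `F₄''` pulled back by `B₁`. -/
def structureM1 : ComplexStructure F4'' :=
  ComplexStructure.ofChart _ injective_B1 isOpen_range_B1

/-! ### Smoothness and mutually inverse differentials of the coordinate changes -/

theorem contDiffAt_coneChartInv_B0 (x : F4'') :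
    ContDiffAt ℝ ∞ coneChartInv (coneChart (B0 x)) :=
  contDiffAt_coneChartInv (coneChart_mem (B0_mem x)).1 (coneChart_mem (B0_mem x)).2

theorem contDiffAt_compare_B0 (x : F4'') : ContDiffAt ℝ ∞ compare (B0 x) :=
  contDiffAt_compare (B0_mem x).2.1

theorem contDiffAt_compareInv_B1 (x : F4'') : ContDiffAt ℝ ∞ compareInv (B1 x) := by
  have := (compare_mem (B0_mem x)).2
  rw [compare_B0] at this
  exact contDiffAt_compareInv this

/-- The differentials of two smooth maps `f` and `g` with `g ∘ f = id` near `p` compose to the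
identity. -/
theorem fderiv_apply_fderiv_of_leftInverse {E F : Type*} [NormedAddCommGroup E] [NormedSpace ℝ E]
    [NormedAddCommGroup F] [NormedSpace ℝ F] {f : E → F} {g : F → E} {p : E}
    (hf : ContDiffAt ℝ ∞ f p) (hg : ContDiffAt ℝ ∞ g (f p)) (h : ∀ᶠ q in nhds p, g (f q) = q)
    (v : E) : fderiv ℝ g (f p) (fderiv ℝ f p v) = v := by
  have h1 := (hg.differentiableAt (by simp)).hasFDerivAt.comp p
    (hf.differentiableAt (by simp)).hasFDerivAt
  have h2 : HasFDerivAt (g ∘ f) (ContinuousLinearMap.id ℝ E) p :=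
    (hasFDerivAt_id p).congr_of_eventuallyEq h
  exact congrArg (fun A : E →L[ℝ] E => A v) (h1.unique h2)

theorem fderiv_coneChartInv_coneChart (x : F4'') (v : ℂ × ℝ × ℝ) :
    fderiv ℝ coneChartInv (coneChart (B0 x)) (fderiv ℝ coneChart (B0 x) v) = v :=
  fderiv_apply_fderiv_of_leftInverse contDiff_coneChart.contDiffAt (contDiffAt_coneChartInv_B0 x)
    (by filter_upwards [isOpen_cone'.mem_nhds (B0_mem x)] with q hq
        using coneChartInv_coneChart hq) v

theorem fderiv_coneChart_coneChartInv (x : F4'') (v : ℂ × ℂ) :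
    fderiv ℝ coneChart (B0 x) (fderiv ℝ coneChartInv (coneChart (B0 x)) v) = v := by
  have := fderiv_apply_fderiv_of_leftInverse (contDiffAt_coneChartInv_B0 x)
    contDiff_coneChart.contDiffAt (by
      filter_upwards [isOpen_image_coneChart.mem_nhds ⟨_, B0_mem x, rfl⟩]
      rintro _ ⟨p, hp, rfl⟩
      rw [coneChartInv_coneChart hp]) v
  rwa [coneChartInv_coneChart_B0] at this

theorem fderiv_compareInv_compare (x : F4'') (v : ℂ × ℝ × ℝ) :
    fderiv ℝ compareInv (B1 x) (fderiv ℝ compare (B0 x) v) = v := by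
  have := fderiv_apply_fderiv_of_leftInverse (g := compareInv) (contDiffAt_compare_B0 x)
    (by rw [compare_B0]; exact contDiffAt_compareInv_B1 x)
    (by filter_upwards [isOpen_cone'.mem_nhds (B0_mem x)] with q hq
        using compareInv_compare hq) v
  rwa [compare_B0] at this

theorem fderiv_compare_compareInv (x : F4'') (v : ℂ × ℂ) :
    fderiv ℝ compare (B0 x) (fderiv ℝ compareInv (B1 x) v) = v := by
  have := fderiv_apply_fderiv_of_leftInverse (f := compareInv) (g := compare)
    (contDiffAt_compareInv_B1 x)
    (by rw [compareInv_B1]; exact contDiffAt_compare_B0 x) (by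
      filter_upwards [isOpen_range_B1.mem_nhds ⟨x, rfl⟩]
      rintro _ ⟨y, rfl⟩
      rw [compareInv_B1, compare_B0]) v
  rwa [compareInv_B1] at this

theorem fderiv_coneChartInv_smul_I (x : F4'') (v : ℂ × ℂ) :
    fderiv ℝ coneChartInv (coneChart (B0 x)) (Complex.I • v) =
      coneJ (B0 x) (fderiv ℝ coneChartInv (coneChart (B0 x)) v) := by
  have h := fderiv_coneChart_coneJ (B0_mem x).1 (B0_mem x).2.1.ne'
    (fderiv ℝ coneChartInv (coneChart (B0 x)) v)
  rw [fderiv_coneChart_coneChartInv] at h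
  rw [← h, fderiv_coneChartInv_coneChart]

theorem coneJ_mem_coneH_B0 {x : F4''} {h : ℂ × ℝ × ℝ} (hh : h ∈ coneH (B0 x)) :
    coneJ (B0 x) h ∈ coneH (B0 x) ∧
      fderiv ℝ compare (B0 x) (coneJ (B0 x) h) = Complex.I • fderiv ℝ compare (B0 x) h :=
  coneJ_mem_coneH (B0_mem x).1 (B0_mem x).2.1 hh

/-! ### Differentials on the two complex manifolds -/

open ComplexStructure

theorem dVec_structureM0 (x : F4'') :
    structureM0.dVec (structureM0.onSpace B0) x =
      fderiv ℝ coneChartInv (coneChart (B0 x)) :=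
  (hasMFDerivAt_onSpace injective_coneChart_B0 isOpen_range_coneChart_B0
    coneChartInv_coneChart_B0 x
    ((contDiffAt_coneChartInv_B0 x).differentiableAt (by simp)).hasFDerivAt).mfderiv

theorem dVec_structureM1 (x : F4'') :
    structureM1.dVec (structureM1.onSpace B0) x = fderiv ℝ compareInv (B1 x) :=
  (hasMFDerivAt_onSpace injective_B1 isOpen_range_B1 compareInv_B1 x
    ((contDiffAt_compareInv_B1 x).differentiableAt (by simp)).hasFDerivAt).mfderiv

theorem dVec_structureM1_B1 (x : F4'') :
    structureM1.dVec (structureM1.onSpace B1) x = ContinuousLinearMap.id ℝ (ℂ × ℂ) :=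
  (hasMFDerivAt_onSpace injective_B1 isOpen_range_B1 (F := id) (fun _ => rfl) x
    (hasFDerivAt_id _)).mfderiv

theorem contDiffAt_compare_coneChartInv (x : F4'') :
    ContDiffAt ℝ ∞ (compare ∘ coneChartInv) (coneChart (B0 x)) :=
  ContDiffAt.comp _ (by rw [coneChartInv_coneChart_B0]; exact contDiffAt_compare_B0 x)
    (contDiffAt_coneChartInv_B0 x)

theorem hasFDerivAt_compare_coneChartInv (x : F4'') :
    HasFDerivAt (compare ∘ coneChartInv)
      ((fderiv ℝ compare (B0 x)).comp (fderiv ℝ coneChartInv (coneChart (B0 x))))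
      (coneChart (B0 x)) := by
  refine HasFDerivAt.comp _ ?_
    ((contDiffAt_coneChartInv_B0 x).differentiableAt (by simp)).hasFDerivAt
  rw [coneChartInv_coneChart_B0]
  exact ((contDiffAt_compare_B0 x).differentiableAt (by simp)).hasFDerivAt

theorem compare_coneChartInv_B0 (x : F4'') :
    (compare ∘ coneChartInv) (coneChart (B0 x)) = B1 x := by
  rw [Function.comp_apply, coneChartInv_coneChart_B0, compare_B0]

theorem dMap_structureM0_structureM1 (x : F4'') :
    dMap structureM0 structureM1 (idMap structureM0 structureM1) x =
      (fderiv ℝ compare (B0 x)).comp (fderiv ℝ coneChartInv (coneChart (B0 x))) :=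
  (hasMFDerivAt_idMap injective_coneChart_B0 isOpen_range_coneChart_B0 injective_B1
    isOpen_range_B1 compare_coneChartInv_B0 x (hasFDerivAt_compare_coneChartInv x)).mfderiv

theorem isBiholomorphicOnto_B0 : structureM0.IsBiholomorphicOnto B0 cone' coneJ := by
  refine ⟨isOpen_cone', bijOn_B0, ?_, ⟨Function.invFun (α := F4'') B0, ?_, ?_⟩, fun (x : F4'') v => ?_⟩
  · exact contMDiff_onSpace injective_coneChart_B0 isOpen_range_coneChart_B0
      coneChartInv_coneChart_B0 contDiffAt_coneChartInv_B0
  · exact Function.leftInverse_invFun (α := F4'') injective_B0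
  · refine contMDiffOn_toSpace injective_coneChart_B0 isOpen_range_coneChart_B0 isOpen_cone'
      (Φ := coneChart) (fun p hp => ?_) fun p _ => contDiff_coneChart.contDiffAt
    rw [← range_B0] at hp
    exact congrArg coneChart (Function.invFun_eq hp)
  · rw [dVec_structureM0]
    exact fderiv_coneChartInv_smul_I x v

theorem isBiholomorphicOnto_B1 :
    structureM1.IsBiholomorphicOnto B1 {q : ℂ × ℂ | q.1 ≠ 0 ∧ q.2.im ≠ 0}
      (fun _ v => Complex.I • v) := by
  have ho : IsOpen {q : ℂ × ℂ | q.1 ≠ 0 ∧ q.2.im ≠ 0} := range_B1 ▸ isOpen_range_B1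
  refine ⟨ho, bijOn_B1, ?_, ⟨Function.invFun (α := F4'') B1, ?_, ?_⟩, fun (x : F4'') v => ?_⟩
  · exact contMDiff_onSpace injective_B1 isOpen_range_B1 (F := id) (fun _ => rfl)
      fun _ => contDiffAt_id
  · exact Function.leftInverse_invFun (α := F4'') injective_B1
  · refine contMDiffOn_toSpace injective_B1 isOpen_range_B1 ho
      (Φ := id) (fun p hp => ?_) fun p _ => contDiffAt_id
    rw [← range_B1] at hp
    exact Function.invFun_eq hp
  · rw [dVec_structureM1_B1]
    rfl

theorem idIsDiffeo_structureM0_structureM1 : IdIsDiffeo structureM0 structureM1 := by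
  refine ⟨contMDiff_idMap injective_coneChart_B0 isOpen_range_coneChart_B0 injective_B1
    isOpen_range_B1 compare_coneChartInv_B0 contDiffAt_compare_coneChartInv,
    contMDiff_idMap injective_B1 isOpen_range_B1 injective_coneChart_B0
    isOpen_range_coneChart_B0 (F := coneChart ∘ compareInv) (fun x => ?_) fun x => ?_⟩
  · rw [Function.comp_apply, compareInv_B1]
  · exact contDiff_coneChart.contDiffAt.comp _ (contDiffAt_compareInv_B1 x)

theorem finrank_comap_of_bijective {E F : Type*} [AddCommGroup E] [Module ℝ E] [AddCommGroup F]
    [Module ℝ F] (A : E →ₗ[ℝ] F) (hA : Function.Bijective A) (W : Submodule ℝ F) :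
    Module.finrank ℝ (W.comap A) = Module.finrank ℝ W := by
  have h := LinearEquiv.finrank_map_eq (LinearEquiv.ofBijective A hA) (W.comap A)
  rw [← h]
  have e : (W.comap A).map ((LinearEquiv.ofBijective A hA : E ≃ₗ[ℝ] F) : E →ₗ[ℝ] F) = W :=
    Submodule.map_comap_eq_of_surjective hA.2 W
  rw [e]

theorem horizontal_structureM0 (x : F4'') : horizontal structureM0 x =
    (coneH (B0 x)).comap (fderiv ℝ coneChartInv (coneChart (B0 x))).toLinearMap :=
  congrArg (fun A : (ℂ × ℂ) →L[ℝ] (ℂ × ℝ × ℝ) => (coneH (B0 x)).comap A.toLinearMap)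
    (dVec_structureM0 x)

theorem horizontal_structureM1 (x : F4'') : horizontal structureM1 x =
    (coneH (B0 x)).comap (fderiv ℝ compareInv (B1 x)).toLinearMap :=
  congrArg (fun A : (ℂ × ℂ) →L[ℝ] (ℂ × ℝ × ℝ) => (coneH (B0 x)).comap A.toLinearMap)
    (dVec_structureM1 x)

theorem isComplexLineField_structureM0 :
    structureM0.IsComplexLineField (horizontal structureM0) := by
  intro (x : F4'')
  rw [horizontal_structureM0]
  refine ⟨?_, fun v hv => ?_⟩
  · exact (finrank_comap_of_bijective _ (Function.bijective_iff_has_inverse.2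
      ⟨_, fderiv_coneChart_coneChartInv x, fderiv_coneChartInv_coneChart x⟩) _).trans
      (finrank_coneH (B0_mem x).1)
  · change fderiv ℝ coneChartInv (coneChart (B0 x)) (Complex.I • v) ∈ coneH (B0 x)
    rw [fderiv_coneChartInv_smul_I]
    exact (coneJ_mem_coneH_B0 hv).1

/-- The differential of `compareInv` does not intertwine `i` with `𝕁` everywhere, but it does on
horizontal vectors, which is enough for stability under `i`. -/
theorem isComplexLineField_structureM1 :
    structureM1.IsComplexLineField (horizontal structureM1) := by
  intro (x : F4'')
  rw [horizontal_structureM1]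
  refine ⟨?_, fun v hv => ?_⟩
  · exact (finrank_comap_of_bijective _ (Function.bijective_iff_has_inverse.2
      ⟨_, fderiv_compare_compareInv x, fderiv_compareInv_compare x⟩) _).trans
      (finrank_coneH (B0_mem x).1)
  · replace hv : fderiv ℝ compareInv (B1 x) v ∈ coneH (B0 x) := hv
    obtain ⟨h1, h2⟩ := coneJ_mem_coneH_B0 hv
    change fderiv ℝ compareInv (B1 x) (Complex.I • v) ∈ coneH (B0 x)
    rw [fderiv_compare_compareInv] at h2
    rwa [← h2, fderiv_compareInv_compare]

theorem isCR_idMap : IsCR structureM0 structureM1 (idMap structureM0 structureM1)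
    (horizontal structureM0) (horizontal structureM1) := by
  refine ⟨idIsDiffeo_structureM0_structureM1.1, fun (x : F4'') v hv => ?_⟩
  rw [horizontal_structureM0] at hv
  replace hv : fderiv ℝ coneChartInv (coneChart (B0 x)) v ∈ coneH (B0 x) := hv
  rw [dMap_structureM0_structureM1, ContinuousLinearMap.comp_apply,
    ContinuousLinearMap.comp_apply, fderiv_coneChartInv_smul_I]
  refine ⟨?_, (coneJ_mem_coneH_B0 hv).2⟩
  change _ ∈ horizontal structureM1 x
  rw [horizontal_structureM1]
  change fderiv ℝ compareInv (B1 x) (fderiv ℝ compare (B0 x)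
    (fderiv ℝ coneChartInv (coneChart (B0 x)) v)) ∈ coneH (B0 x)
  rwa [fderiv_compareInv_compare]

theorem not_idIsBiholomorphic : ¬ IdIsBiholomorphic structureM0 structureM1 := by
  rintro ⟨h, -⟩
  obtain ⟨x⟩ := (inferInstance : Nonempty F4'')
  have hd := differentiableAt_of_mdifferentiableAt_idMap injective_coneChart_B0
    isOpen_range_coneChart_B0 injective_B1 isOpen_range_B1 compare_coneChartInv_B0 x (h x)
  have hu := (hasFDerivAt_compare_coneChartInv x).unique (hd.hasFDerivAt.restrictScalars ℝ)
  have hlin : ∀ v, fderiv ℝ compare (B0 x) (fderiv ℝ coneChartInv (coneChart (B0 x))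
      (Complex.I • v)) = Complex.I • fderiv ℝ compare (B0 x)
        (fderiv ℝ coneChartInv (coneChart (B0 x)) v) := by
    intro v
    have e := fun w => congrArg (fun A : (ℂ × ℂ) →L[ℝ] (ℂ × ℂ) => A w) hu
    simp only [ContinuousLinearMap.comp_apply, ContinuousLinearMap.coe_restrictScalars'] at e
    rw [e, e, map_smul]
  -- Test on the vector corresponding to `S`: its `z`-component is `0`, while that of `𝕁 S = T` is
  -- `iz ≠ 0`.
  have hS := congrArg Prod.fst (hlin (fderiv ℝ coneChart (B0 x) (fieldS (B0 x))))
  have hr := (B0_mem x).2.1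
  rw [fderiv_coneChartInv_smul_I, fderiv_coneChartInv_coneChart, coneJ_S hr.ne', Prod.smul_fst,
    fderiv_compare_fst hr, fderiv_compare_fst hr] at hS
  have hz := (B0_mem x).1
  simp [fieldT, fieldS, hz] at hS

end FourPoints

end

theorem mainTheorem3 :
    (∀ x : FourPoints.F4'', ∃! q : ℝ × ℂ × ℝ, FourPoints.IsNormalForm x q) ∧
    ∃ M₀ M₁ : FourPoints.ComplexStructure FourPoints.F4'',
      M₀.IsBiholomorphicOnto FourPoints.B0 FourPoints.cone' FourPoints.coneJ ∧
      M₁.IsBiholomorphicOnto FourPoints.B1 {q : ℂ × ℂ | q.1 ≠ 0 ∧ q.2.im ≠ 0}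
        (fun _ v => Complex.I • v) ∧
      FourPoints.ComplexStructure.IdIsDiffeo M₀ M₁ ∧
      M₀.IsComplexLineField (FourPoints.horizontal M₀) ∧
      M₁.IsComplexLineField (FourPoints.horizontal M₁) ∧
      FourPoints.ComplexStructure.IsCR M₀ M₁ (FourPoints.ComplexStructure.idMap M₀ M₁)
        (FourPoints.horizontal M₀) (FourPoints.horizontal M₁) ∧
      ¬ FourPoints.ComplexStructure.IdIsBiholomorphic M₀ M₁ :=
  ⟨FourPoints.existsUnique_isNormalForm, FourPoints.structureM0, FourPoints.structureM1,
    FourPoints.isBiholomorphicOnto_B0, FourPoints.isBiholomorphicOnto_B1,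
    FourPoints.idIsDiffeo_structureM0_structureM1, FourPoints.isComplexLineField_structureM0,
    FourPoints.isComplexLineField_structureM1, FourPoints.isCR_idMap,
    FourPoints.not_idIsBiholomorphic⟩
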